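/- Let $d\ge 1$ and let $\Delta=\operatorname{conv}(v_1,\dots,v_{2d})\subset\mathbb R^{2d-1}$ be a $(2d-1)$-dimensional lattice simplex, i.e. $v_1,\dots,v_{2d}\in\mathbb Z^{2d-1}$ are affinely independent. Assume that every codimension-one facet of $\Delta$ is a basic lattice simplex, where a lattice simplex $\operatorname{conv}(w_0,\dots,w_k)\subset\mathbb R^m$ is called basic if $w_1-w_0,\dots,w_k-w_0$ is part of a $\mathbb Z$-basis of $\mathbb Z^m$. The Cayley polytope of lattice polytopes $\Sigma_1,\dots,\Sigma_d\subset\mathbb R^d$ is $\Sigma_1*\dots*\Sigma_d:=\operatorname{conv}\bigl(\bigcup_i \{e_i\}\times\Sigma_i\bigr)\subset\mathbb R^{d}\times\mathbb R^{d}$. Two lattice polytopes $P\subset\mathbb R^{m}$ and $Q\subset\mathbb R^{m'}$ are isomorphic, $P\cong Q$, if there is an affine bijection from the affine hull of $P$ to the affine hull of $Q$ which maps $P$ onto $Q$ and the lattice points of the affine hull of $P$ onto the lattice points of the affine hull of $Q$. For integers $a_1,\dots,a_{d-1},n$ with $n>0$ and $\gcd(a_1\cdots a_{d-1},n)=1$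 (the empty product being $1$) put $$\Delta(a_1,\dots,a_{d-1},n):=\Delta_1*\dots*\Delta_d,\qquad \Delta_i=\operatorname{conv}(0,e_i)\ (1\le i\le d-1),\quad \Delta_d=\operatorname{conv}(0,(a_1,\dots,a_{d-1},n)).$$ The $h^*$-polynomial of $\Delta$ is $h^*_\Delta(t):=(1-t)^{2d}\bigl(1+\sum_{k\ge1}|k\Delta\cap\mathbb Z^{2d-1}|\,t^k\bigr)$. Then the following statements are equivalent: 1. For all $k=1,\dots,d-1$, every $x\in k\Delta\cap\mathbb Z^{2d-1}$ can be written as $x=\sum_{i=1}^{2d}c_iv_i$ with integers $c_i$ satisfying $\sum_i c_i=k$; equivalently, $(k\Delta\cap\mathbb Z^{2d-1})\times\{k\}\subset\mathbb Z(v_1,1)+\dots+\mathbb Z(v_{2d},1)$. 2. For all $k=1,\dots,d-1$, $\operatorname{Int}(k\Delta)\cap\mathbb Z^{2d-1}=\emptyset$. 3. $h^*_\Delta=1+(n-1)t^d$ for some integer $n\ge1$. 4. $\Delta\cong\Delta(a_1,\dots,a_{d-1},n)$ for some integers $a_1,\dots,a_{d-1},n$ with $n>0$ and $\gcd(a_1\cdots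 a_{d-1},n)=1$. 5. $\Delta\cong\Delta_1*\dots*\Delta_d$ for some one-dimensional lattice simplices (lattice segments) $\Delta_1,\dots,\Delta_d\subset\mathbb R^d$. -/

import Mathlib

open scoped Pointwise BigOperators

/-- The lattice vector `x ∈ ℤ^ι`, regarded as a vector of `ℝ^ι`. -/
def realVec {ι : Type*} (x : ι → ℤ) : ι → ℝ := fun j => (x j : ℝ)

/-- The polytope `conv(v_i : i ∈ σ)` spanned by lattice points `v_i ∈ ℤ^ι`. -/
def latticeHull {σ ι : Type*} (v : σ → ι → ℤ) : Set (ι → ℝ) :=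
  convexHull ℝ (Set.range fun i => realVec (v i))

/-- The points `v_i` are the vertices of a simplex, i.e. they are affinely independent over `ℝ`. -/
def IsLatticeSimplex {σ ι : Type*} (v : σ → ι → ℤ) : Prop :=
  AffineIndependent ℝ (fun i => realVec (v i))

/-- `conv(v_i : i ∈ σ)` is a basic lattice simplex: for a base vertex `v_{i₀}`, the differences
`v_i - v_{i₀}`, `i ≠ i₀`, are (distinct) members of a basis of the lattice `ℤ^ι`. -/
def IsBasicLatticeSimplex {σ ι : Type*} (v : σ → ι → ℤ) : Prop :=
  ∃ (i₀ : σ) (b : Module.Basis ι ℤ (ι → ℤ)) (f : {i : σ // i ≠ i₀} ↪ ι),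
    ∀ i : {i : σ // i ≠ i₀}, b (f i) = v i - v i₀

/-- The vertices of the codimension one facet opposite to the vertex `v_j`. -/
def facet {σ ι : Type*} (v : σ → ι → ℤ) (j : σ) : {i : σ // i ≠ j} → ι → ℤ :=
  fun i => v i

/-- Isomorphism of lattice polytopes: an affine map which restricts to a bijection of the affine
hulls, maps the lattice points of the one affine hull onto those of the other, and maps `P`
onto `Q`. (Equality of the affine hulls' images follows from `φ '' P = Q`.) -/
def LatticeIsomorphic {ι κ : Type*} (P : Set (ι → ℝ)) (Q : Set (κ → ℝ)) : Prop :=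
  ∃ φ : (ι → ℝ) →ᵃ[ℝ] (κ → ℝ),
    Set.InjOn φ (affineSpan ℝ P : Set (ι → ℝ)) ∧ φ '' P = Q ∧
      φ '' ((affineSpan ℝ P : Set (ι → ℝ)) ∩ Set.range realVec) =
        (affineSpan ℝ Q : Set (κ → ℝ)) ∩ Set.range realVec

/-- The Cayley polytope `Σ_1 * ⋯ * Σ_r`: the convex hull of the sets `e_i × Σ_i`. -/
def cayley {κ ι : Type*} [DecidableEq κ] (S : κ → Set (ι → ℝ)) : Set (κ ⊕ ι → ℝ) :=
  convexHull ℝ (⋃ i : κ, (fun x : ι → ℝ => (Sum.elim (Pi.single i 1) x : κ ⊕ ι → ℝ)) '' S i)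

/-- `e_1, …, e_{d-1}, (a_1, …, a_{d-1}, n)`: the nonzero end points of the `d` segments
that define `Δ(a_1, …, a_{d-1}, n)`. -/
def standardEndpoint {d : ℕ} (a : Fin (d - 1) → ℤ) (n : ℤ) (i : Fin d) : Fin d → ℤ :=
  if i.val < d - 1 then Pi.single i 1
  else fun j => if h : j.val < d - 1 then a ⟨j.val, h⟩ else n

/-- `Δ(a_1, …, a_{d-1}, n)`, the Cayley polytope of the segments `conv(0, e_i)` for `i < d` and
`conv(0, (a_1, …, a_{d-1}, n))`. -/
def standardCayley {d : ℕ} (a : Fin (d - 1) → ℤ) (n : ℤ) : Set (Fin d ⊕ Fin d → ℝ) :=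
  cayley fun i : Fin d => segment ℝ (0 : Fin d → ℝ) (realVec (standardEndpoint a n i))

/-- The number of lattice points of `kP`. -/
noncomputable def ehrhartCount {ι : Type*} (P : Set (ι → ℝ)) (k : ℕ) : ℕ :=
  Set.ncard {x : ι → ℤ | realVec x ∈ (k : ℝ) • P}

/-- The Ehrhart series `1 + ∑_{k ≥ 1} |kP ∩ ℤ^ι| t^k`. -/
noncomputable def ehrhartSeries {ι : Type*} (P : Set (ι → ℝ)) : PowerSeries ℤ :=
  PowerSeries.mk fun k => if k = 0 then 1 else (ehrhartCount P k : ℤ)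

/-- `h*_P = (1 - t)^(m + 1) · (Ehrhart series of P)` for a full-dimensional lattice polytope `P`
in `ℝ^m`; as a formal power series in `t`. -/
noncomputable def hStar {m : ℕ} (P : Set (Fin m → ℝ)) : PowerSeries ℤ :=
  (1 - PowerSeries.X) ^ (m + 1) * ehrhartSeries P

/-!
Write `x = (x_i)` for real coefficients with `∑ x_i (v_i, 1) ∈ ℤ^(2d-1) × ℤ`. These vectors form a
lattice containing `ℤ^(2d)`, here called `coeffLattice v`; it determines the simplex up to lattice
isomorphism (`latticeIsomorphic_of_coeffLattice_eq`). That the facet opposite to `v_j` is basic means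
that an element of the coefficient lattice with integral `j`-th coordinate is integral
(`exists_eq_realVec_of_facet_basic`). Hence the quotient by `ℤ^(2d)` is cyclic, generated by some
`u = b / n` with all `b_i` prime to `n` (`exists_generator_coeffLattice`,
`IsCoeffGenerator.isCoprime`), and the representative of a nonzero class in the cube `[0, 1)^(2d)`
has only positive coordinates. Call `∑ x_i` the height of `x`. All five conditions are equivalent to

  every nonzero class has a representative of height exactly `d` in the cube (`HasConstantHeight`).

* Splitting coefficients into integral and fractional parts, lattice points of `kΔ` outside the
  lattice spanned by the vertices exist for some `k < d` if and only if some class has height less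
  than `d`; such a representative is also interior. The symmetry `x ↦ 1 - x` exchanges the heights
  `k` and `2d - k`, so the heights are all at least `d` only if they are all equal to `d`.
* The same splitting shows `h^*(t) = ∑ t^(height of the class)` (`IsCoeffGenerator.hStar_eq`).
* On a Cayley polytope of `d` polytopes, the first `d` coordinates are nonnegative and integral with
  sum `1`, so at an interior lattice point of the `k`-th dilate they are positive integers with
  sum `k`; thus `k ≥ d`.
* Conversely, constant height says `∑ {m b_i / n} = d` for all `m` not divisible by `n`. Pairing this
  relation with an odd Dirichlet character `χ` gives `B_{1, χ⁻¹} · ∑ χ(b_i) = 0`, and the generalized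
  Bernoulli number of a primitive odd character is nonzero since `L(1, χ) ≠ 0`
  (`sum_inv_mul_val_ne_zero`). So `∑ χ(b_i) = 0` for all odd `χ`, and by orthogonality of characters
  the residues `b_i` fall into pairs `b, -b` modulo `n` (`HasConstantHeight.exists_pairing`). If `u` is
  normalized to have last coordinate `1 / n`, this is the coefficient lattice of
  `Δ(a_1, …, a_{d-1}, n)` with `a_i = -b_i` (`IsCoeffGenerator.coeffLattice_eq_standard`).
-/

/-! ### Values of the odd Hurwitz zeta function at `1` -/

theorem abs_rpow_neg_sub_rpow_neg_le {m x y s : ℝ} (hm : 0 < m) (hx : m ≤ x) (hy : m ≤ y)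
    (hs : 0 ≤ s) : |x ^ (-s) - y ^ (-s)| ≤ s * m ^ (-s - 1) * |x - y| := by
  have := (convex_Ici m).norm_image_sub_le_of_norm_hasDerivWithin_le (f := fun t : ℝ => t ^ (-s))
    (f' := fun t => -s * t ^ (-s - 1)) (C := s * m ^ (-s - 1)) (x := y) (y := x)
    (fun t ht => (Real.hasDerivAt_rpow_const
      (Or.inl (hm.trans_le ht).ne')).hasDerivWithinAt) (fun t ht => ?_) hy hx
  · simpa only [Real.norm_eq_abs] using this
  · have ht0 : 0 < t := hm.trans_le ht
    rw [norm_mul, Real.norm_eq_abs, abs_neg, abs_of_nonneg hs, Real.norm_eq_abs,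
      abs_of_pos (Real.rpow_pos_of_pos ht0 _)]
    exact mul_le_mul_of_nonneg_left
      (Real.rpow_le_rpow_of_nonpos hm ht (by linarith)) hs

open Filter Topology in
/-- The Mittag-Leffler expansion of the cotangent, with the poles grouped as the
odd Hurwitz zeta function groups them. -/
theorem tendsto_sum_range_inv_sub_inv {a : ℝ} (ha : a ∈ Set.Ioo (0 : ℝ) 1) :
    Tendsto (fun M : ℕ => ∑ n ∈ Finset.range M, (1 / (n + a : ℂ) - 1 / (n + 1 - a : ℂ))) atTop
      (𝓝 (Real.pi * Complex.cot (Real.pi * a))) := by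
  have hc : (a : ℂ) ∈ Complex.integerComplement := by
    rintro ⟨k, hk⟩
    have hk' : (k : ℝ) = a := by exact_mod_cast hk
    have h0 : (0 : ℝ) < k := hk' ▸ ha.1
    have h1 : (k : ℝ) < 1 := hk' ▸ ha.2
    norm_cast at h0 h1
    lia
  have h1 := tendsto_logDeriv_euler_cot_sub hc
  have h2 : Tendsto (fun M : ℕ => 1 / ((M : ℂ) + a)) atTop (𝓝 0) := by
    have : Tendsto (fun M : ℕ => 1 / ((M : ℝ) + a)) atTop (𝓝 0) :=
      Tendsto.comp (tendsto_const_nhds.div_atTop tendsto_id)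
        (tendsto_atTop_add_const_right _ a tendsto_natCast_atTop_atTop)
    have := (Complex.continuous_ofReal.tendsto 0).comp this
    simpa [Function.comp_def] using this
  have h3 := ((h1.const_add (1 / (a : ℂ))).sub h2)
  convert h3 using 2 with M
  · induction M with
    | zero => simp
    | succ M ih =>
      rw [Finset.sum_range_succ, ih, Finset.sum_range_succ, cotTerm]
      have e : 1 / ((M : ℂ) + 1 - a) = -(1 / ((a : ℂ) - (M + 1))) := by
        rw [← neg_sub, one_div, inv_neg, one_div]
      rw [e]
      push_cast
      rw [add_comm (a : ℂ) ((M : ℂ) + 1)]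
      ring
  · ring

open Filter Topology in
/-- The value at `1` of the odd Hurwitz zeta function, obtained by letting `s → 1⁺` in its
Dirichlet series. -/
theorem hurwitzZetaOdd_apply_one {a : ℝ} (ha : a ∈ Set.Ioo (0 : ℝ) 1) :
    HurwitzZeta.hurwitzZetaOdd (a : UnitAddCircle) 1 =
      Real.pi / 2 * Complex.cot (Real.pi * a) := by
  obtain ⟨ha0, ha1⟩ := ha
  set f : ℝ → ℕ → ℝ := fun s n => ((n + a) ^ (-s) - (n + 1 - a) ^ (-s)) / 2 with hf
  set δ : ℝ := min a (1 - a) with hδ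
  have hδ0 : 0 < δ := lt_min ha0 (by linarith)
  have hδa : δ ≤ a := min_le_left _ _
  have hδb : δ ≤ 1 - a := min_le_right _ _
  have hδ1 : δ ≤ 1 := by linarith
  have hbound : ∀ s ∈ Set.Icc (1 : ℝ) 2, ∀ n : ℕ,
      ‖f s n‖ ≤ δ ^ (-3 : ℝ) * (1 / ((n + 1 : ℕ) : ℝ) ^ 2) := by
    intro s hs n
    have hn : (0 : ℝ) ≤ n := n.cast_nonneg
    have hn1 : (1 : ℝ) ≤ n + 1 := by linarith
    have hm : 0 < δ * (n + 1) := by positivity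
    have h1 : δ * (n + 1) ≤ n + a := by nlinarith
    have h2 : δ * (n + 1) ≤ n + 1 - a := by nlinarith
    have key := abs_rpow_neg_sub_rpow_neg_le hm h1 h2 (s := s) (by linarith [hs.1])
    have h3 : |(n + a) - (n + 1 - a)| ≤ 1 := by
      rw [abs_le]; constructor <;> linarith
    have h4 : (δ * (n + 1)) ^ (-s - 1) ≤ δ ^ (-3 : ℝ) * (1 / ((n + 1 : ℕ) : ℝ) ^ 2) := by
      rw [Real.mul_rpow hδ0.le (by linarith)]
      have e : (1 / ((n + 1 : ℕ) : ℝ) ^ 2) = ((n : ℝ) + 1) ^ (-2 : ℝ) := by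
        rw [Real.rpow_neg (by linarith)]
        norm_num
      rw [e]
      exact mul_le_mul
        (Real.rpow_le_rpow_of_exponent_ge hδ0 hδ1 (by linarith [hs.2]))
        (Real.rpow_le_rpow_of_exponent_le hn1 (by linarith [hs.1])) (by positivity) (by positivity)
    have hp : 0 ≤ (δ * (n + 1)) ^ (-s - 1) := by positivity
    rw [hf, Real.norm_eq_abs, abs_div, abs_two]
    calc _ ≤ (s * (δ * (n + 1)) ^ (-s - 1) * |(n + a) - (n + 1 - a)|) / 2 := by gcongr
      _ ≤ (2 * (δ * (n + 1)) ^ (-s - 1) * 1) / 2 := by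
          gcongr
          exact hs.2
      _ = (δ * (n + 1)) ^ (-s - 1) := by ring
      _ ≤ _ := h4
  have hsum : Summable fun n : ℕ => δ ^ (-3 : ℝ) * (1 / ((n + 1 : ℕ) : ℝ) ^ 2) :=
    ((summable_nat_add_iff 1).mpr (Real.summable_one_div_nat_pow.mpr one_lt_two)).mul_left _
  -- the value of the Dirichlet series for `s > 1`
  have hval : ∀ s : ℝ, 1 < s →
      HurwitzZeta.hurwitzZetaOdd (a : UnitAddCircle) s = ((∑' n, f s n : ℝ) : ℂ) := by
    intro s hs
    have := HurwitzZeta.hasSum_nat_hurwitzZetaOdd_of_mem_Icc (a := a) ⟨ha0.le, ha1.le⟩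
      (s := (s : ℂ)) (by simpa using hs)
    rw [← this.tsum_eq, Complex.ofReal_tsum]
    refine tsum_congr fun n => ?_
    have hn : (0 : ℝ) ≤ n := n.cast_nonneg
    have e1 : (0 : ℝ) ≤ n + a := by linarith
    have e2 : (0 : ℝ) ≤ n + 1 - a := by linarith
    simp only [hf]
    rw [Real.rpow_neg e1, Real.rpow_neg e2]
    push_cast [Complex.ofReal_cpow e1, Complex.ofReal_cpow e2]
    simp only [one_div]
  have hlim : Tendsto (fun s : ℝ => ∑' n, f s n) (𝓝[>] 1) (𝓝 (∑' n, f 1 n)) := by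
    refine tendsto_tsum_of_dominated_convergence hsum (fun n => ?_) ?_
    · have hn : (0 : ℝ) ≤ n := n.cast_nonneg
      have : Continuous fun s : ℝ => f s n := by
        simp only [hf]
        have h1 : (n + a : ℝ) ≠ 0 := by positivity
        have h2 : (n + 1 - a : ℝ) ≠ 0 := by linarith
        exact ((continuous_const.rpow continuous_neg fun _ => Or.inl h1).sub
          (continuous_const.rpow continuous_neg fun _ => Or.inl h2)).div_const 2
      exact (this.tendsto 1).mono_left nhdsWithin_le_nhds
    · filter_upwards [Ioc_mem_nhdsGT (show (1 : ℝ) < 2 by norm_num)] with s hs n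
      exact hbound s ⟨hs.1.le, hs.2⟩ n
  have hlim2 : Tendsto (fun s : ℝ => HurwitzZeta.hurwitzZetaOdd (a : UnitAddCircle) (s : ℂ))
      (𝓝[>] 1) (𝓝 (HurwitzZeta.hurwitzZetaOdd (a : UnitAddCircle) 1)) := by
    have : Continuous fun s : ℝ => HurwitzZeta.hurwitzZetaOdd (a : UnitAddCircle) (s : ℂ) :=
      (HurwitzZeta.differentiable_hurwitzZetaOdd _).continuous.comp Complex.continuous_ofReal
    simpa using (this.tendsto 1).mono_left nhdsWithin_le_nhds
  have h1 : HurwitzZeta.hurwitzZetaOdd (a : UnitAddCircle) 1 = ((∑' n, f 1 n : ℝ) : ℂ) := by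
    refine tendsto_nhds_unique hlim2 (Tendsto.congr' ?_
      ((Complex.continuous_ofReal.tendsto _).comp hlim))
    filter_upwards [self_mem_nhdsWithin] with s hs
    exact (hval s hs).symm
  have hs1 : Summable (f 1) :=
    Summable.of_norm_bounded hsum (hbound 1 ⟨le_rfl, one_le_two⟩)
  have h2 := (Complex.continuous_ofReal.tendsto _).comp hs1.hasSum.tendsto_sum_nat
  have h3 := (tendsto_sum_range_inv_sub_inv ⟨ha0, ha1⟩).div_const 2
  rw [h1]
  refine (tendsto_nhds_unique h2 (h3.congr fun M => ?_)).trans (by ring)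
  simp only [Function.comp, hf, Complex.ofReal_sum, Finset.sum_div, Real.rpow_neg_one]
  refine Finset.sum_congr rfl fun n _ => ?_
  push_cast
  simp only [one_div]

/-! ### Generalized Bernoulli numbers of odd characters -/

theorem sum_range_natCast_mul_pow_of_pow_eq_one {N : ℕ} {w : ℂ} (hw : w ^ N = 1) (hw1 : w ≠ 1) :
    ∑ j ∈ Finset.range N, (j : ℂ) * w ^ j = N / (w - 1) := by
  have key : ∀ M : ℕ, (w - 1) * ∑ j ∈ Finset.range M, (j : ℂ) * w ^ j =
      M * w ^ M - ∑ j ∈ Finset.range M, w ^ (j + 1) := by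
    intro M
    induction M with
    | zero => simp
    | succ M ih =>
      rw [Finset.sum_range_succ, mul_add, ih, Finset.sum_range_succ]
      push_cast
      ring
  have h1 : w - 1 ≠ 0 := sub_ne_zero.mpr hw1
  have h2 : ∑ j ∈ Finset.range N, w ^ (j + 1) = 0 := by
    simp_rw [pow_succ]
    rw [← Finset.sum_mul, geom_sum_eq hw1, hw, sub_self, zero_div, zero_mul]
  rw [eq_div_iff h1, mul_comm, key, hw, h2]
  ring

/-- The finite Fourier transform of the sawtooth `j ↦ j` on `ℤ/N` is, up to constants, the
cotangent. -/
theorem cot_eq_sum_val_mul_stdAddChar {N : ℕ} [NeZero N] {k : ZMod N} (hk : k ≠ 0) :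
    Complex.cot (Real.pi * (k.val / N : ℝ)) =
      Complex.I * (2 / N * ∑ j : ZMod N, (j.val : ℂ) * ZMod.stdAddChar (j * k) + 1) := by
  have hN : (N : ℂ) ≠ 0 := NeZero.ne _
  set w : ℂ := ZMod.stdAddChar k with hw
  have hwexp : w = Complex.exp (2 * Real.pi * Complex.I * (k.val / N : ℝ)) := by
    have := ZMod.stdAddChar_coe (N := N) (k.val : ℤ)
    rw [Int.cast_natCast, ZMod.natCast_zmod_val] at this
    rw [hw, this]
    push_cast
    ring_nf
  have hw1 : w ≠ 1 := by
    intro h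
    apply hk
    apply ZMod.injective_stdAddChar (N := N)
    rw [← hw, h, AddChar.map_zero_eq_one]
  have hwN : w ^ N = 1 := by
    rw [hw, ← AddChar.map_nsmul_eq_pow, nsmul_eq_mul, CharP.cast_eq_zero, zero_mul,
      AddChar.map_zero_eq_one]
  have hsum : ∑ j : ZMod N, (j.val : ℂ) * ZMod.stdAddChar (j * k) = N / (w - 1) := by
    rw [← sum_range_natCast_mul_pow_of_pow_eq_one hwN hw1]
    refine Finset.sum_bij (fun j _ => j.val) (fun j _ => Finset.mem_range.mpr j.val_lt)
      (fun _ _ _ _ h => ZMod.val_injective N h)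
      (fun m hm => ⟨(m : ZMod N), Finset.mem_univ _,
        ZMod.val_cast_of_lt (Finset.mem_range.mp hm)⟩) (fun j _ => ?_)
    rw [hw, ← AddChar.map_nsmul_eq_pow, nsmul_eq_mul, ZMod.natCast_zmod_val]
  have h1 : w - 1 ≠ 0 := sub_ne_zero.mpr hw1
  have h2 : 1 - w ≠ 0 := sub_ne_zero.mpr hw1.symm
  rw [hsum, Complex.cot_pi_eq_exp_ratio, ← hwexp]
  rw [div_eq_iff (mul_ne_zero Complex.I_ne_zero h2)]
  field_simp
  linear_combination (w ^ 2 - 1) * Complex.I_sq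

/-- The generalized Bernoulli number `B_{1,χ⁻¹}` of a primitive odd character `χ` does not vanish,
because `L(1, χ) ≠ 0` is a multiple of it. -/
theorem sum_inv_mul_val_ne_zero {N : ℕ} [NeZero N] {χ : DirichletCharacter ℂ N}
    (hχ : χ.IsPrimitive) (hodd : χ.Odd) : ∑ j : ZMod N, χ⁻¹ j * (j.val : ℂ) ≠ 0 := by
  have hne : χ ≠ 1 := by
    rintro rfl
    rw [DirichletCharacter.Odd, MulChar.one_apply (by simp)] at hodd
    norm_num at hodd
  have hN1 : N ≠ 1 := fun h => hne (DirichletCharacter.level_one' χ h)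
  have hL := DirichletCharacter.LFunction_apply_one_ne_zero hne
  intro h0
  apply hL
  have hcot : ∀ j : ZMod N, χ j * HurwitzZeta.hurwitzZetaOdd (ZMod.toAddCircle j) 1 =
      Real.pi / 2 * Complex.I * (2 / N * ∑ l : ZMod N, (l.val : ℂ) *
        (χ j * ZMod.stdAddChar (l * j)) + χ j) := by
    intro j
    by_cases hj : j = 0
    · subst hj
      simp [DirichletCharacter.map_zero' χ hN1]
    · have hv : (j.val : ℝ) / N ∈ Set.Ioo (0 : ℝ) 1 := by
        have hNp : (0 : ℝ) < N := Nat.cast_pos.mpr (NeZero.pos N)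
        refine ⟨div_pos (Nat.cast_pos.mpr ((ZMod.val_pos).mpr hj)) hNp, ?_⟩
        rw [div_lt_one hNp]
        exact_mod_cast j.val_lt
      rw [ZMod.toAddCircle_apply, hurwitzZetaOdd_apply_one hv, cot_eq_sum_val_mul_stdAddChar hj]
      have : ∑ l : ZMod N, (l.val : ℂ) * (χ j * ZMod.stdAddChar (l * j)) =
          χ j * ∑ l : ZMod N, (l.val : ℂ) * ZMod.stdAddChar (l * j) := by
        rw [Finset.mul_sum]
        exact Finset.sum_congr rfl fun l _ => by ring
      rw [this]
      ring
  have hgauss : ∀ l : ZMod N, ∑ j : ZMod N, χ j * ZMod.stdAddChar (l * j) =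
      χ⁻¹ l * gaussSum χ ZMod.stdAddChar := fun l => by
    rw [← gaussSum_mulShift_of_isPrimitive _ hχ]
    rfl
  rw [DirichletCharacter.LFunction, ZMod.LFunction_def_odd hodd.to_fun, Finset.sum_congr rfl
    fun j _ => hcot j, ← Finset.mul_sum, Finset.sum_add_distrib, χ.sum_eq_zero_of_ne_one hne,
    ← Finset.mul_sum, Finset.sum_comm]
  simp_rw [← Finset.mul_sum, hgauss]
  have : ∑ i : ZMod N, (i.val : ℂ) * (χ⁻¹ i * gaussSum χ ZMod.stdAddChar) = 0 := by
    rw [← zero_mul (gaussSum χ ZMod.stdAddChar), ← h0, Finset.sum_mul]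
    exact Finset.sum_congr rfl fun l _ => by ring
  rw [this]
  simp

/-! ### Sums of fractional parts and pairs of residues -/

theorem fract_intCast_div_natCast {N : ℕ} [NeZero N] (z : ℤ) :
    Int.fract ((z : ℝ) / N) = ((z : ZMod N).val : ℝ) / N := by
  rw [Int.fract_div_intCast_eq_div_intCast_mod, ← ZMod.val_intCast, Int.cast_natCast]

/-- If the fractional parts of `m b_i / n` have the same sum for all `m` not divisible by `n`, then
`∑ χ(b_i) = 0` for every odd character `χ` modulo `n`. The multiples of `n / f`, where `f` is the
conductor of `χ`, give a relation modulo `f`, which is then paired with the primitive character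
inducing `χ`. -/
theorem sum_char_eq_zero_of_sum_fract_const {ι : Type*} [Fintype ι] {n : ℕ} [NeZero n]
    {b : ι → ℤ} (hb : ∀ i, IsCoprime (b i) n) {c : ℝ}
    (h : ∀ m : ℤ, ¬ (n : ℤ) ∣ m → ∑ i, Int.fract ((m * b i : ℤ) / (n : ℝ)) = c)
    (χ : DirichletCharacter ℂ n) (hodd : χ.Odd) : ∑ i, χ (b i) = 0 := by
  set f := χ.conductor with hf
  have : NeZero f := ⟨χ.conductor_ne_zero⟩
  set ψ := χ.primitiveCharacter with hψ
  obtain ⟨g, hg⟩ : f ∣ n := χ.conductor_dvd_level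
  have hg0 : g ≠ 0 := by rintro rfl; exact NeZero.ne n (by simpa using hg)
  have hψodd : ψ.Odd := by
    have := χ.primitiveCharacter_apply_of_isCoprime (a := -1) (isCoprime_one_left.neg_left)
    simp only [Int.cast_neg, Int.cast_one] at this
    exact this.trans hodd
  have hψ1 : ψ ≠ 1 := by
    intro h1
    rw [h1, DirichletCharacter.Odd, MulChar.one_apply (by simp)] at hψodd
    norm_num at hψodd
  have hf1 : f ≠ 1 := fun h1 => hψ1 (DirichletCharacter.level_one' ψ h1)
  have hval : ∀ j : ZMod f, j ≠ 0 → ∑ i, (((j * (b i : ZMod f)).val : ℕ) : ℂ) = (c * f : ℝ) := by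
    intro j hj
    have hdvd : ¬ (n : ℤ) ∣ g * (j.val : ℤ) := by
      intro hd
      rw [hg] at hd
      have : f ∣ j.val := by
        have h1 : g * f ∣ g * j.val := by
          rw [mul_comm g f]
          exact_mod_cast hd
        exact Nat.dvd_of_mul_dvd_mul_left (Nat.pos_of_ne_zero hg0) h1
      exact hj ((ZMod.val_eq_zero j).mp (Nat.eq_zero_of_dvd_of_lt this j.val_lt))
    have := h _ hdvd
    have hgr : (g : ℝ) ≠ 0 := Nat.cast_ne_zero.mpr hg0
    have hfr : (f : ℝ) ≠ 0 := NeZero.ne _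
    rw [← this, Finset.sum_mul, Complex.ofReal_sum]
    refine Finset.sum_congr rfl fun i _ => ?_
    have e : (((g : ℤ) * (j.val : ℤ) * b i : ℤ) : ℝ) / (n : ℝ) =
        (((j.val : ℤ) * b i : ℤ) : ℝ) / (f : ℝ) := by
      rw [hg]
      push_cast
      field_simp
    rw [e, fract_intCast_div_natCast, div_mul_cancel₀ _ hfr, Int.cast_mul, Int.cast_natCast,
      ZMod.natCast_zmod_val, Complex.ofReal_natCast]
  have hb' : ∀ i, IsUnit ((b i : ℤ) : ZMod f) := fun i => by
    rw [ZMod.coe_int_isUnit_iff_isCoprime, isCoprime_comm]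
    exact (hb i).of_isCoprime_of_dvd_right (by exact_mod_cast χ.conductor_dvd_level)
  -- the relation, averaged against `ψ⁻¹`
  have hzero : ∑ j : ZMod f, ψ⁻¹ j * ∑ i, (((j * (b i : ZMod f)).val : ℕ) : ℂ) = 0 := by
    have : ∀ j : ZMod f, ψ⁻¹ j * ∑ i, (((j * (b i : ZMod f)).val : ℕ) : ℂ) =
        ψ⁻¹ j * (c * f : ℝ) := by
      intro j
      by_cases hj : j = 0
      · subst hj
        rw [DirichletCharacter.map_zero' _ hf1, zero_mul, zero_mul]
      · rw [hval j hj]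
    simp_rw [this]
    rw [← Finset.sum_mul, MulChar.sum_eq_zero_of_ne_one (inv_ne_one.mpr hψ1), zero_mul]
  have hsub : ∀ i, ∑ j : ZMod f, ψ⁻¹ j * (((j * (b i : ZMod f)).val : ℕ) : ℂ) =
      ψ (b i) * ∑ j : ZMod f, ψ⁻¹ j * (j.val : ℂ) := by
    intro i
    obtain ⟨u, hu⟩ := hb' i
    rw [← hu, Finset.mul_sum]
    refine Fintype.sum_equiv (Units.mulRight u) _ _ fun j => ?_
    rw [Units.mulRight_apply, map_mul, ← mul_assoc]
    congr 1
    have : ψ u * ψ⁻¹ u = 1 := by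
      rw [← MulChar.mul_apply, mul_inv_cancel, MulChar.one_apply u.isUnit]
    linear_combination (- ψ⁻¹ j) * this
  simp_rw [Finset.mul_sum] at hzero
  rw [Finset.sum_comm] at hzero
  simp_rw [hsub] at hzero
  rw [← Finset.sum_mul] at hzero
  have hB := sum_inv_mul_val_ne_zero χ.primitiveCharacter_isPrimitive hψodd
  rw [← (mul_eq_zero.mp hzero).resolve_right hB]
  exact Finset.sum_congr rfl fun i _ => (χ.primitiveCharacter_apply_of_isCoprime (hb i)).symm

/-- If the fractional parts of `m b_i / n` have the same sum for all `m` not divisible by `n`, then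
the residues `b_i` and `-b_i` occur equally often. -/
theorem card_eq_card_neg_of_sum_fract_const {ι : Type*} [Fintype ι] {n : ℕ} [NeZero n]
    {b : ι → ℤ} (hb : ∀ i, IsCoprime (b i) n) {c : ℝ}
    (h : ∀ m : ℤ, ¬ (n : ℤ) ∣ m → ∑ i, Int.fract ((m * b i : ℤ) / (n : ℝ)) = c)
    {u : ZMod n} (hu : IsUnit u) :
    (Finset.univ.filter fun i => (b i : ZMod n) = u).card =
      (Finset.univ.filter fun i => (b i : ZMod n) = -u).card := by
  have hsum : ∀ χ : DirichletCharacter ℂ n, ∑ i, χ (b i) = ∑ i, χ (-(b i)) := by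
    intro χ
    rcases χ.even_or_odd with he | ho
    · exact Finset.sum_congr rfl fun i _ => (he.eval_neg _ _).symm
    · simp_rw [ho.eval_neg]
      rw [Finset.sum_neg_distrib, sum_char_eq_zero_of_sum_fract_const hb h χ ho, neg_zero]
  have hcount : ∀ b' : ι → ZMod n, ∑ χ : DirichletCharacter ℂ n, χ u⁻¹ * ∑ i, χ (b' i) =
      (Finset.univ.filter fun i => b' i = u).card * (n.totient : ℂ) := by
    intro b'
    simp_rw [Finset.mul_sum]
    rw [Finset.sum_comm]
    simp_rw [DirichletCharacter.sum_char_inv_mul_char_eq ℂ hu]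
    rw [Finset.card_filter, Nat.cast_sum, Finset.sum_mul]
    refine Finset.sum_congr rfl fun i _ => ?_
    simp [eq_comm]
  have h1 := hcount fun i => (b i : ZMod n)
  simp_rw [hsum] at h1
  rw [hcount fun i => -(b i : ZMod n)] at h1
  have ht : (n.totient : ℂ) ≠ 0 :=
    Nat.cast_ne_zero.mpr (Nat.totient_pos.mpr (NeZero.pos n)).ne'
  have h2 := Nat.cast_injective (mul_right_cancel₀ ht h1)
  rw [← h2]
  simp_rw [neg_eq_iff_eq_neg]

/-- A family of `2 d` units modulo `n` in which `u` and `-u` occur equally often can be arranged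
in `d` pairs `u, -u`. -/
theorem exists_equiv_sum_of_card_eq_card_neg {d n : ℕ} [NeZero n] {b : Fin (2 * d) → ZMod n}
    (hb : ∀ i, IsUnit (b i))
    (h : ∀ u : ZMod n, IsUnit u → (Finset.univ.filter fun i => b i = u).card =
      (Finset.univ.filter fun i => b i = -u).card) :
    ∃ σ : Fin d ⊕ Fin d ≃ Fin (2 * d), ∀ i, b (σ (Sum.inl i)) = -b (σ (Sum.inr i)) := by
  rcases Nat.lt_or_ge 2 n with hn | hn
  · have hval : ∀ u : ZMod n, IsUnit u → (-u).val = n - u.val ∧ 2 * u.val ≠ n := by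
      intro u hu
      have : Fact (1 < n) := ⟨by lia⟩
      have h0 : u ≠ 0 := hu.ne_zero
      have : NeZero u := ⟨h0⟩
      refine ⟨ZMod.val_neg_of_ne_zero u, fun h2 => ?_⟩
      have h3 : (2 : ZMod n) * u = 0 := by
        rw [← ZMod.natCast_zmod_val u]
        exact_mod_cast (congrArg (Nat.cast : ℕ → ZMod n) h2).trans (CharP.cast_eq_zero _ n)
      have h4 : ((2 : ℕ) : ZMod n) = 0 := by
        push_cast
        exact (hu.mul_left_eq_zero).mp h3
      have := Nat.le_of_dvd two_pos ((ZMod.natCast_eq_zero_iff 2 n).mp h4)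
      lia
    -- `S` picks one residue out of each pair `u, -u`
    let S : Fin (2 * d) → Prop := fun i => 2 * (b i).val < n
    have hfib : ∀ u : ZMod n, Nonempty
        ({i : {i // S i} // b i = u} ≃ {i : {i // ¬ S i} // -b i = u}) := by
      intro u
      refine ⟨Fintype.equivOfCardEq ?_⟩
      by_cases hu : IsUnit u ∧ 2 * u.val < n
      · have e1 : {i : {i // S i} // b i = u} ≃ {i // b i = u} :=
          Equiv.subtypeSubtypeEquivSubtype fun {i} (hi : b i = u) => by
            change 2 * (b i).val < n
            rw [hi]
            exact hu.2
        have e2 : {i : {i // ¬ S i} // -b i = u} ≃ {i // b i = -u} :=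
          (Equiv.subtypeSubtypeEquivSubtype fun {i} (hi : -b i = u) => by
            change ¬ 2 * (b i).val < n
            rw [neg_eq_iff_eq_neg.mp hi, (hval u hu.1).1]
            have := hu.2
            lia).trans (Equiv.subtypeEquivRight fun i => neg_eq_iff_eq_neg)
        rw [Fintype.card_congr e1, Fintype.card_congr e2, Fintype.card_subtype,
          Fintype.card_subtype]
        exact h u hu.1
      · have h1 : IsEmpty {i : {i // S i} // b i = u} :=
          ⟨fun i => hu (i.2 ▸ ⟨hb _, i.1.2⟩)⟩
        have h2 : IsEmpty {i : {i // ¬ S i} // -b i = u} := by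
          refine ⟨fun i => hu (i.2 ▸ ⟨(hb _).neg, ?_⟩)⟩
          have h3 := i.1.2
          have h4 := hval _ (hb i.1)
          have h5 := (b i.1).val_lt
          rw [h4.1]
          change ¬ 2 * (b i.1).val < n at h3
          lia
        rw [Fintype.card_eq_zero, Fintype.card_eq_zero]
    let e := fun u => (hfib u).some
    let E : {i // S i} ≃ {i // ¬ S i} :=
      Equiv.ofFiberEquiv (f := fun i : {i // S i} => b i)
        (g := fun i : {i // ¬ S i} => -b i) e
    have hE : ∀ i, -b (E i) = b i := fun i =>
      Equiv.ofFiberEquiv_map (f := fun i : {i // S i} => b i)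
        (g := fun i : {i // ¬ S i} => -b i) e i
    have hcard : Fintype.card {i // S i} = Fintype.card (Fin d) := by
      have h1 := Fintype.card_congr (Equiv.sumCompl S)
      rw [Fintype.card_sum, ← Fintype.card_congr E, Fintype.card_fin] at h1
      rw [Fintype.card_fin]
      lia
    let τ : Fin d ≃ {i // S i} := (Fintype.equivOfCardEq hcard).symm
    exact ⟨(Equiv.sumCongr τ (τ.trans E)).trans (Equiv.sumCompl S), fun i => (hE (τ i)).symm⟩
  · have hone : ∀ u : ZMod n, IsUnit u → u = 1 ∧ u = -1 := by
      have := NeZero.pos n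
      interval_cases n <;> decide
    refine ⟨finSumFinEquiv.trans (finCongr (two_mul d).symm), fun i => ?_⟩
    rw [(hone _ (hb _)).2, (hone (b _) (hb _)).1]

/-! ### The coefficient lattice of a lattice simplex -/

section RealVec
variable {ι : Type*}

theorem realVec_injective : Function.Injective (realVec : (ι → ℤ) → ι → ℝ) := fun x y h => by
  ext j
  exact Int.cast_injective (congrFun h j : (x j : ℝ) = y j)

theorem realVec_add (x y : ι → ℤ) : realVec (x + y) = realVec x + realVec y := by
  ext j; simp [realVec]

theorem realVec_sub (x y : ι → ℤ) : realVec (x - y) = realVec x - realVec y := by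
  ext j; simp [realVec]

theorem realVec_zsmul (m : ℤ) (x : ι → ℤ) : realVec (m • x) = (m : ℝ) • realVec x := by
  ext j; simp [realVec]

theorem realVec_zero : realVec (0 : ι → ℤ) = 0 := by
  ext j; simp [realVec]

theorem realVec_sum {σ : Type*} (s : Finset σ) (x : σ → ι → ℤ) :
    realVec (∑ i ∈ s, x i) = ∑ i ∈ s, realVec (x i) := by
  ext j; simp [realVec, Finset.sum_apply]

/-- An integral linear form on `ℤ^ι` extends to a real linear form on `ℝ^ι`. -/
theorem exists_linearMap_realVec [Fintype ι] (g : (ι → ℤ) →ₗ[ℤ] ℤ) :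
    ∃ G : (ι → ℝ) →ₗ[ℝ] ℝ, ∀ z, G (realVec z) = g z := by
  classical
  refine ⟨∑ k, ((g (Pi.single k 1) : ℤ) : ℝ) • LinearMap.proj k, fun z => ?_⟩
  conv_rhs => rw [pi_eq_sum_univ' z, map_sum]
  simp_rw [map_smul]
  simp [LinearMap.sum_apply, realVec, mul_comm]

end RealVec

section RelationLattice
variable {σ ι : Type*} [Fintype σ]

/-- The real vectors of coefficients `x` for which `∑ x_i (v_i, 1)` is a lattice point of
`ℝ^ι × ℝ`. It contains `ℤ^σ`, and its quotient by `ℤ^σ` is the quotient of `ℤ^ι × ℤ` by the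
sublattice generated by the vectors `(v_i, 1)`. -/
def coeffLattice (v : σ → ι → ℤ) : AddSubgroup (σ → ℝ) where
  carrier := {x | (∃ k : ℤ, ∑ i, x i = k) ∧ ∃ y : ι → ℤ, ∑ i, x i • realVec (v i) = realVec y}
  zero_mem' := ⟨⟨0, by simp⟩, 0, by simp [realVec_zero]⟩
  add_mem' := by
    rintro x x' ⟨⟨k, hk⟩, y, hy⟩ ⟨⟨k', hk'⟩, y', hy'⟩
    refine ⟨⟨k + k', ?_⟩, y + y', ?_⟩
    · simp [Finset.sum_add_distrib, hk, hk']
    · simp [add_smul, Finset.sum_add_distrib, hy, hy', realVec_add]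
  neg_mem' := by
    rintro x ⟨⟨k, hk⟩, y, hy⟩
    refine ⟨⟨-k, ?_⟩, (-1 : ℤ) • y, ?_⟩
    · simp [hk]
    · rw [realVec_zsmul]
      simp [neg_smul, hy]

theorem realVec_mem_coeffLattice (v : σ → ι → ℤ) (z : σ → ℤ) : realVec z ∈ coeffLattice v := by
  refine ⟨⟨∑ i, z i, by simp [realVec]⟩, ∑ i, z i • v i, ?_⟩
  rw [realVec_sum]
  simp_rw [realVec_zsmul]
  rfl

theorem fract_mem_coeffLattice {v : σ → ι → ℤ} {x : σ → ℝ} (hx : x ∈ coeffLattice v) :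
    (fun i => Int.fract (x i)) ∈ coeffLattice v := by
  have : (fun i => Int.fract (x i)) = x - realVec fun i => ⌊x i⌋ := by
    ext i; exact (Int.self_sub_floor (x i)).symm
  rw [this]
  exact sub_mem hx (realVec_mem_coeffLattice v _)

/-- An integral linear form `g`, evaluated on `∑ x_i (v_i - w)` for `x` in the coefficient
lattice. -/
theorem exists_int_sum_mul_eq [Fintype ι] {v : σ → ι → ℤ} {x : σ → ℝ} (hx : x ∈ coeffLattice v)
    (g : (ι → ℤ) →ₗ[ℤ] ℤ) (w : ι → ℤ) : ∃ m : ℤ, ∑ i, x i * (g (v i - w) : ℝ) = m := by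
  obtain ⟨⟨k, hk⟩, y, hy⟩ := hx
  obtain ⟨G, hG⟩ := exists_linearMap_realVec g
  refine ⟨g (y - k • w), ?_⟩
  have : ∑ i, x i • (realVec (v i) - realVec w) = realVec y - (k : ℝ) • realVec w := by
    simp_rw [smul_sub]
    rw [Finset.sum_sub_distrib, ← Finset.sum_smul, hk, hy]
  rw [← hG, realVec_sub, realVec_zsmul, ← this, map_sum]
  exact Finset.sum_congr rfl fun i _ => by rw [map_smul, ← realVec_sub, hG, smul_eq_mul]

/-- If the facet opposite to `v_j` is basic, then an element of the coefficient lattice is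
integral as soon as its `j`-th coordinate is. -/
theorem exists_eq_realVec_of_facet_basic [Fintype ι] {v : σ → ι → ℤ} {j : σ}
    (hj : IsBasicLatticeSimplex (facet v j)) {x : σ → ℝ} (hx : x ∈ coeffLattice v)
    (hxj : ∃ m : ℤ, x j = m) : ∃ z : σ → ℤ, x = realVec z := by
  classical
  obtain ⟨i₀, b, f, hf⟩ := hj
  obtain ⟨m, hm⟩ := hxj
  have hother : ∀ i : σ, i ≠ i₀ → ∃ z : ℤ, x i = z := by
    intro i hi
    by_cases hij : i = j
    · exact ⟨m, hij ▸ hm⟩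
    have hi' : (⟨i, hij⟩ : {i // i ≠ j}) ≠ i₀ := fun h => hi (congrArg Subtype.val h)
    obtain ⟨t, ht⟩ := exists_int_sum_mul_eq hx (b.coord (f ⟨⟨i, hij⟩, hi'⟩)) (v i₀)
    have hval : ∀ l, (hl : l ≠ j) → (hl' : l ≠ i₀) →
        b.coord (f ⟨⟨i, hij⟩, hi'⟩) (v l - v i₀) = if l = i then 1 else 0 := by
      intro l hl hl'
      have hl'' : (⟨l, hl⟩ : {i // i ≠ j}) ≠ i₀ := fun h => hl' (congrArg Subtype.val h)
      have := hf ⟨⟨l, hl⟩, hl''⟩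
      simp only [facet] at this
      rw [← this, Module.Basis.coord_apply, Module.Basis.repr_self, Finsupp.single_apply]
      simp only [f.injective.eq_iff, Subtype.mk.injEq]
    rw [Fintype.sum_eq_add i j hij] at ht
    · rw [hval i hij hi, if_pos rfl, hm] at ht
      refine ⟨t - m * b.coord (f ⟨⟨i, hij⟩, hi'⟩) (v j - v i₀), ?_⟩
      push_cast at ht ⊢
      linarith
    · rintro l ⟨h1, h2⟩
      by_cases hl : l = i₀
      · simp [hl]
      · rw [hval l h2 hl, if_neg h1]
        simp
  have hall : ∀ i, ∃ z : ℤ, x i = z := by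
    intro i
    by_cases hi : i = i₀
    · choose z hz using hother
      obtain ⟨⟨k, hk⟩, -⟩ := hx
      refine ⟨k - ∑ l : {l : σ // l ≠ i₀}, z l l.2, ?_⟩
      have h1 : ∑ l : {l : σ // l ≠ i₀}, x l = ∑ l ∈ Finset.univ.erase (i₀ : σ), x l :=
        (Finset.sum_subtype _ (by simp) _).symm
      have h2 := Finset.add_sum_erase Finset.univ x (Finset.mem_univ (i₀ : σ))
      push_cast
      simp_rw [← hz]
      rw [h1, ← hk, ← h2, hi]
      ring
    · exact hother i hi
  choose z hz using hall
  exact ⟨z, funext hz⟩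

/-- A lattice simplex of full dimension gives an affine basis. -/
theorem IsLatticeSimplex.exists_affineBasis [Fintype ι] {v : σ → ι → ℤ} (hv : IsLatticeSimplex v)
    (hc : Fintype.card σ = Fintype.card ι + 1) :
    ∃ B : AffineBasis σ ℝ (ι → ℝ), ∀ i, B i = realVec (v i) :=
  ⟨⟨_, hv, hv.affineSpan_eq_top_iff_card_eq_finrank_add_one.mpr (by simpa using hc)⟩,
    fun _ => rfl⟩

/-- The coefficient lattice of a simplex with a basic facet opposite to `v_j` is generated by
`ℤ^σ` and one element `u` with `u_j = 1 / n`. -/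
theorem exists_generator_coeffLattice [Fintype ι] {v : σ → ι → ℤ} (hv : IsLatticeSimplex v)
    (hc : Fintype.card σ = Fintype.card ι + 1) {j : σ}
    (hj : IsBasicLatticeSimplex (facet v j)) :
    ∃ n : ℕ, 0 < n ∧ ∃ u ∈ coeffLattice v, u j = 1 / n ∧
      ∀ x ∈ coeffLattice v, ∃ (m : ℤ) (z : σ → ℤ), x = m • u + realVec z := by
  classical
  obtain ⟨i₀, b, f, hf⟩ := id hj
  obtain ⟨m, hm⟩ : ∃ m : ι, m ∉ Set.range f := by
    by_contra! h
    have h1 := Fintype.card_le_of_surjective f h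
    rw [Fintype.card_subtype_compl, Fintype.card_subtype_compl] at h1
    simp only [Fintype.card_unique] at h1
    have : 0 < Fintype.card σ := Fintype.card_pos_iff.mpr ⟨j⟩
    have : 0 < Fintype.card {i // i ≠ j} := Fintype.card_pos_iff.mpr ⟨i₀⟩
    rw [Fintype.card_subtype_compl] at this
    simp only [Fintype.card_unique] at this
    lia
  set N : ℤ := b.coord m (v j - v i₀) with hN
  -- the `m`-th coordinate only sees the vertex `v_j`
  have hcoord : ∀ x : σ → ℝ, ∑ i, x i * (b.coord m (v i - v i₀) : ℝ) = x j * N := by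
    intro x
    refine Fintype.sum_eq_single j fun i hi => ?_
    by_cases hi' : i = i₀
    · simp [hi']
    · have hi'' : (⟨i, hi⟩ : {i // i ≠ j}) ≠ i₀ := fun h => hi' (congrArg Subtype.val h)
      have h1 := hf ⟨⟨i, hi⟩, hi''⟩
      simp only [facet] at h1
      rw [← h1, Module.Basis.coord_apply, Module.Basis.repr_self, Finsupp.single_apply,
        if_neg fun h => hm ⟨_, h⟩]
      simp
  obtain ⟨B, hB⟩ := hv.exists_affineBasis hc
  -- barycentric coordinates of a lattice point at lattice distance `1` from the facet
  set u : σ → ℝ := fun i => B.coord i (realVec (b m + v i₀)) with hu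
  have hu1 : ∑ i, u i = 1 := B.sum_coord_apply_eq_one _
  have hu2 : ∑ i, u i • realVec (v i) = realVec (b m + v i₀) := by
    have := B.linear_combination_coord_eq_self (realVec (b m + v i₀))
    simpa only [hB] using this
  have huL : u ∈ coeffLattice v := ⟨⟨1, by simp [hu1]⟩, _, hu2⟩
  have huN : u j * N = 1 := by
    obtain ⟨G, hG⟩ := exists_linearMap_realVec (b.coord m)
    rw [← hcoord u]
    have h1 : ∀ i, u i * (b.coord m (v i - v i₀) : ℝ) = G (u i • realVec (v i)) -
        u i * G (realVec (v i₀)) := fun i => by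
      rw [map_smul, ← hG, realVec_sub, map_sub, smul_eq_mul, mul_sub]
    simp_rw [h1]
    rw [Finset.sum_sub_distrib, ← Finset.sum_mul, hu1, ← map_sum, hu2, realVec_add, map_add,
      hG (b m), Module.Basis.coord_apply, Module.Basis.repr_self]
    simp
  have hN0 : N ≠ 0 := by
    intro h
    rw [h] at huN
    simp at huN
  have hgen : ∀ u' ∈ coeffLattice v, ∀ ε : ℤ, u' j * (ε * N) = 1 → ∀ x ∈ coeffLattice v,
      ∃ (t : ℤ) (z : σ → ℤ), x = t • u' + realVec z := by
    intro u' hu' ε hε x hx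
    obtain ⟨t, ht⟩ := exists_int_sum_mul_eq hx (b.coord m) (v i₀)
    rw [hcoord] at ht
    have hN0' : (N : ℝ) ≠ 0 := Int.cast_ne_zero.mpr hN0
    obtain ⟨z, hz⟩ := exists_eq_realVec_of_facet_basic hj
      (sub_mem hx (zsmul_mem hu' (t * ε))) ⟨0, by
        rw [Pi.sub_apply, Pi.smul_apply, zsmul_eq_mul, Int.cast_zero, sub_eq_zero]
        refine mul_right_cancel₀ hN0' ?_
        rw [ht]
        push_cast
        linear_combination (-t : ℝ) * hε⟩
    exact ⟨t * ε, z, by rw [← hz]; abel⟩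
  rcases lt_or_gt_of_ne hN0 with hneg | hpos
  · refine ⟨N.natAbs, by lia, -u, neg_mem huL, ?_, hgen _ (neg_mem huL) (-1) ?_⟩
    · have : ((N.natAbs : ℕ) : ℝ) = -(N : ℝ) := by
        rw [Nat.cast_natAbs, abs_of_neg hneg]; push_cast; rfl
      rw [this, Pi.neg_apply, eq_div_iff (by simpa using hN0)]
      linarith
    · push_cast
      rw [Pi.neg_apply]
      linarith
  · refine ⟨N.natAbs, by lia, u, huL, ?_, hgen _ huL 1 (by push_cast; linarith)⟩
    have : ((N.natAbs : ℕ) : ℝ) = (N : ℝ) := by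
      rw [Nat.cast_natAbs, abs_of_pos hpos]
    rw [this, eq_div_iff (by simpa using hN0)]
    exact huN

end RelationLattice

/-! ### Heights and lattice points of dilates -/

theorem realVec_eq_zero_of_mem_Ico {σ : Type*} {z : σ → ℤ} (h : ∀ i, realVec z i ∈ Set.Ico (0 : ℝ) 1) :
    realVec z = 0 := by
  ext i
  obtain ⟨h0, h1⟩ := h i
  simp only [realVec] at h0 h1 ⊢
  norm_cast at h0 h1
  have : z i = 0 := by lia
  simp [this]

section Heights
variable {σ ι : Type*} [Fintype σ]

theorem IsLatticeSimplex.eq_of_sum_eq {v : σ → ι → ℤ} (hv : IsLatticeSimplex v) {x x' : σ → ℝ}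
    (h1 : ∑ i, x i = ∑ i, x' i)
    (h2 : ∑ i, x i • realVec (v i) = ∑ i, x' i • realVec (v i)) : x = x' := by
  have h := (affineIndependent_iff.mp hv) Finset.univ (x - x')
    (by simp [Finset.sum_sub_distrib, h1]) (by simp [sub_smul, Finset.sum_sub_distrib, h2])
  ext i
  exact sub_eq_zero.mp (h i (Finset.mem_univ i))

theorem AffineBasis.coord_eq_of_sum_eq {E : Type*} [AddCommGroup E] [Module ℝ E]
    (B : AffineBasis σ ℝ E) {x : σ → ℝ} (hx : ∑ i, x i = 1) {w : E}
    (hw : ∑ i, x i • B i = w) (i : σ) : B.coord i w = x i := by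
  rw [← hw, ← Finset.univ.affineCombination_eq_linear_combination _ _ hx]
  exact B.coord_apply_combination_of_mem (Finset.mem_univ i) hx

/-- Dilates of a region that is cut out by a condition on the barycentric coordinates. -/
theorem AffineBasis.mem_smul_iff {E : Type*} [AddCommGroup E] [Module ℝ E]
    (B : AffineBasis σ ℝ E) {p : ℝ → Prop} {k : ℝ} (hk : 0 < k) (hp : ∀ t, p (k * t) ↔ p t)
    {w : E} : w ∈ k • {y | ∀ i, p (B.coord i y)} ↔
      ∃ x : σ → ℝ, (∀ i, p (x i)) ∧ ∑ i, x i = k ∧ ∑ i, x i • B i = w := by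
  rw [Set.mem_smul_set_iff_inv_smul_mem₀ hk.ne']
  constructor
  · intro h
    refine ⟨fun i => k * B.coord i (k⁻¹ • w), fun i => (hp _).mpr (h i), ?_, ?_⟩
    · rw [← Finset.mul_sum, B.sum_coord_apply_eq_one, mul_one]
    · simp_rw [mul_smul]
      rw [← Finset.smul_sum, B.linear_combination_coord_eq_self, smul_inv_smul₀ hk.ne']
  · rintro ⟨x, hx, hsum, hw⟩ i
    rw [B.coord_eq_of_sum_eq (x := fun i => k⁻¹ * x i)]
    · rw [← hp, mul_inv_cancel_left₀ hk.ne']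
      exact hx i
    · rw [← Finset.mul_sum, hsum, inv_mul_cancel₀ hk.ne']
    · simp_rw [mul_smul]
      rw [← Finset.smul_sum, hw]

theorem mem_smul_latticeHull_iff [Fintype ι] {v : σ → ι → ℤ} (hv : IsLatticeSimplex v)
    (hc : Fintype.card σ = Fintype.card ι + 1) {k : ℝ} (hk : 0 < k) {w : ι → ℝ} :
    w ∈ k • latticeHull v ↔
      ∃ x : σ → ℝ, (∀ i, 0 ≤ x i) ∧ ∑ i, x i = k ∧ ∑ i, x i • realVec (v i) = w := by
  obtain ⟨B, hB⟩ := hv.exists_affineBasis hc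
  have := B.mem_smul_iff (p := fun t => 0 ≤ t) hk (fun t => mul_nonneg_iff_of_pos_left hk) (w := w)
  simp_rw [hB] at this
  rw [← this, ← B.convexHull_eq_nonneg_coord, latticeHull, ← funext hB]

theorem mem_interior_smul_latticeHull_iff [Fintype ι] {v : σ → ι → ℤ} (hv : IsLatticeSimplex v)
    (hc : Fintype.card σ = Fintype.card ι + 1) {k : ℝ} (hk : 0 < k) {w : ι → ℝ} :
    w ∈ interior (k • latticeHull v) ↔
      ∃ x : σ → ℝ, (∀ i, 0 < x i) ∧ ∑ i, x i = k ∧ ∑ i, x i • realVec (v i) = w := by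
  obtain ⟨B, hB⟩ := hv.exists_affineBasis hc
  have := B.mem_smul_iff (p := fun t => 0 < t) hk (fun t => mul_pos_iff_of_pos_left hk) (w := w)
  simp_rw [hB] at this
  rw [← this, ← B.interior_convexHull, interior_smul₀ hk.ne', latticeHull, ← funext hB]

/-- All nonzero elements of the half-open unit cube in the coefficient lattice have height `d`.
These elements represent the nonzero classes of the coefficient lattice modulo `ℤ^σ`. -/
def HasConstantHeight (v : σ → ι → ℤ) (d : ℕ) : Prop :=
  ∀ x ∈ coeffLattice v, (∀ i, x i ∈ Set.Ico (0 : ℝ) 1) → x ≠ 0 → ∑ i, x i = d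

/-- All facets of the simplex are basic, as a property of its coefficient lattice. -/
def IsFacetBasic (v : σ → ι → ℤ) : Prop :=
  ∀ x ∈ coeffLattice v, ∀ j, (∃ m : ℤ, x j = m) → ∃ z : σ → ℤ, x = realVec z

theorem IsFacetBasic.pos_of_mem_Ico {v : σ → ι → ℤ} (hF : IsFacetBasic v) {x : σ → ℝ}
    (hx : x ∈ coeffLattice v) (h : ∀ i, x i ∈ Set.Ico (0 : ℝ) 1) (h0 : x ≠ 0) (i : σ) :
    0 < x i := by
  refine lt_of_le_of_ne (h i).1 fun hi => h0 ?_
  obtain ⟨z, rfl⟩ := hF x hx i ⟨0, by simp [← hi]⟩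
  exact realVec_eq_zero_of_mem_Ico h

/-- Passing from `x` to `1 - x` exchanges the heights `k` and `2 d - k`. Hence a lower bound for the
heights determines them. -/
theorem IsFacetBasic.hasConstantHeight_of_le {v : σ → ι → ℤ} (hF : IsFacetBasic v) {d : ℕ}
    (hd : Fintype.card σ = 2 * d)
    (h : ∀ x ∈ coeffLattice v, (∀ i, x i ∈ Set.Ioo (0 : ℝ) 1) → (d : ℝ) ≤ ∑ i, x i) :
    HasConstantHeight v d := by
  intro x hx hx1 hx0
  have hpos := hF.pos_of_mem_Ico hx hx1 hx0
  refine le_antisymm ?_ (h x hx fun i => ⟨hpos i, (hx1 i).2⟩)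
  have h2 := h (realVec (fun _ => 1) - x) (sub_mem (realVec_mem_coeffLattice v _) hx)
    fun i => by
      have := hpos i
      have := (hx1 i).2
      simp only [Pi.sub_apply, realVec, Int.cast_one, Set.mem_Ioo]
      constructor <;> linarith
  simp only [Pi.sub_apply, realVec, Int.cast_one, Finset.sum_sub_distrib, Finset.sum_const,
    Finset.card_univ, hd, nsmul_eq_mul, mul_one] at h2
  push_cast at h2
  linarith

/-- Unless it is integral, a nonnegative element of the coefficient lattice has at least the height
of its fractional part. -/
theorem HasConstantHeight.eq_realVec_of_sum_lt {v : σ → ι → ℤ} {d : ℕ} (h : HasConstantHeight v d)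
    {x : σ → ℝ} (hx : x ∈ coeffLattice v) (hx0 : ∀ i, 0 ≤ x i) (hlt : ∑ i, x i < d) :
    x = realVec fun i => ⌊x i⌋ := by
  by_contra hne
  have hfr : (fun i => Int.fract (x i)) ≠ 0 := by
    intro h0
    apply hne
    ext i
    have h1 := Int.floor_add_fract (x i)
    rw [show Int.fract (x i) = 0 from congrFun h0 i, add_zero] at h1
    exact h1.symm
  have := h _ (fract_mem_coeffLattice hx)
    (fun i => ⟨Int.fract_nonneg _, Int.fract_lt_one _⟩) hfr
  have h2 : ∑ i, Int.fract (x i) ≤ ∑ i, x i :=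
    Finset.sum_le_sum fun i _ => by
      have : (0 : ℝ) ≤ ⌊x i⌋ := Int.cast_nonneg (Int.floor_nonneg.mpr (hx0 i))
      rw [← Int.self_sub_floor]
      linarith
  linarith

variable [Fintype ι]

theorem hasConstantHeight_iff_integral_combination {v : σ → ι → ℤ} (hv : IsLatticeSimplex v)
    (hc : Fintype.card σ = Fintype.card ι + 1) (hF : IsFacetBasic v) {d : ℕ}
    (hd : Fintype.card σ = 2 * d) :
    (∀ k : ℕ, 1 ≤ k → k < d → ∀ x : ι → ℤ, realVec x ∈ (k : ℝ) • latticeHull v →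
      ∃ c : σ → ℤ, ∑ i, c i = (k : ℤ) ∧ x = ∑ i, c i • v i) ↔ HasConstantHeight v d := by
  have hne : Nonempty σ := Fintype.card_pos_iff.mp (by lia)
  constructor
  · intro h
    refine hF.hasConstantHeight_of_le hd fun x hx hx1 => ?_
    obtain ⟨⟨k, hk⟩, y, hy⟩ := id hx
    by_contra! hlt
    have hpos : 0 < ∑ i, x i := Finset.sum_pos (fun i _ => (hx1 i).1) Finset.univ_nonempty
    rw [hk] at hlt hpos
    norm_cast at hlt hpos
    lift k to ℕ using hpos.le
    obtain ⟨c, hc1, hc2⟩ := h k (by lia) (by lia) y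
      ((mem_smul_latticeHull_iff hv hc (by exact_mod_cast hpos)).mpr
        ⟨x, fun i => (hx1 i).1.le, hk, hy⟩)
    have hxc : x = realVec c := by
      refine hv.eq_of_sum_eq ?_ ?_
      · rw [hk, ← hc1]
        simp [realVec]
      · rw [hy, hc2, realVec_sum]
        simp_rw [realVec_zsmul]
        rfl
    obtain ⟨i⟩ := hne
    have h0 := congrFun (realVec_eq_zero_of_mem_Ico (z := c)
      fun i => hxc ▸ ⟨(hx1 i).1.le, (hx1 i).2⟩) i
    rw [← hxc] at h0
    exact (hx1 i).1.ne' h0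
  · intro h k hk hkd x hx
    have hk0 : (0 : ℝ) < k := by exact_mod_cast hk
    obtain ⟨y, hy0, hy1, hy2⟩ := (mem_smul_latticeHull_iff hv hc hk0).mp hx
    have hyL : y ∈ coeffLattice v := ⟨⟨k, by exact_mod_cast hy1⟩, x, hy2⟩
    have hyz := h.eq_realVec_of_sum_lt hyL hy0 (by rw [hy1]; exact_mod_cast hkd)
    refine ⟨fun i => ⌊y i⌋, ?_, ?_⟩
    · have : ∑ i, realVec (fun i => ⌊y i⌋) i = k := by rw [← hyz, hy1]
      simp only [realVec] at this
      exact_mod_cast this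
    · apply realVec_injective
      rw [realVec_sum, ← hy2]
      simp_rw [realVec_zsmul]
      exact Finset.sum_congr rfl fun i _ => by
        conv_lhs => rw [hyz]
        rfl

theorem hasConstantHeight_iff_interior {v : σ → ι → ℤ} (hv : IsLatticeSimplex v)
    (hc : Fintype.card σ = Fintype.card ι + 1) (hF : IsFacetBasic v) {d : ℕ}
    (hd : Fintype.card σ = 2 * d) :
    (∀ k : ℕ, 1 ≤ k → k < d → interior ((k : ℝ) • latticeHull v) ∩ Set.range realVec = ∅) ↔
      HasConstantHeight v d := by
  have hne : Nonempty σ := Fintype.card_pos_iff.mp (by lia)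
  constructor
  · intro h
    refine hF.hasConstantHeight_of_le hd fun x hx hx1 => ?_
    obtain ⟨⟨k, hk⟩, y, hy⟩ := id hx
    by_contra! hlt
    have hpos : 0 < ∑ i, x i := Finset.sum_pos (fun i _ => (hx1 i).1) Finset.univ_nonempty
    rw [hk] at hlt hpos
    norm_cast at hlt hpos
    lift k to ℕ using hpos.le
    refine Set.eq_empty_iff_forall_notMem.mp (h k (by lia) (by lia)) (realVec y) ⟨?_, y, rfl⟩
    exact (mem_interior_smul_latticeHull_iff hv hc (by exact_mod_cast hpos)).mpr
        ⟨x, fun i => (hx1 i).1, hk, hy⟩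
  · intro h k hk hkd
    rw [Set.eq_empty_iff_forall_notMem]
    rintro _ ⟨hw, x, rfl⟩
    have hk0 : (0 : ℝ) < k := by exact_mod_cast hk
    obtain ⟨y, hy0, hy1, hy2⟩ := (mem_interior_smul_latticeHull_iff hv hc hk0).mp hw
    have hyL : y ∈ coeffLattice v := ⟨⟨k, by exact_mod_cast hy1⟩, x, hy2⟩
    have hyz := h.eq_realVec_of_sum_lt hyL (fun i => (hy0 i).le)
      (by rw [hy1]; exact_mod_cast hkd)
    -- positive integral coefficients have sum at least `2 d`
    have h1 : ∀ i, (1 : ℝ) ≤ y i := fun i => by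
      have := hy0 i
      rw [hyz] at this ⊢
      simp only [realVec] at this ⊢
      exact_mod_cast this
    have h2 := Finset.sum_le_sum fun i (_ : i ∈ Finset.univ) => h1 i
    rw [hy1, Finset.sum_const, Finset.card_univ, hd, nsmul_one] at h2
    norm_cast at h2
    lia

end Heights

/-! ### Cayley polytopes have constant height -/

theorem cayley_subset_stdSimplex {ι κ : Type*} [Fintype κ] [DecidableEq κ] (S : κ → Set (ι → ℝ)) {y : κ ⊕ ι → ℝ} (hy : y ∈ cayley S) :
    (fun l => y (Sum.inl l)) ∈ stdSimplex ℝ κ := by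
  have hlin : IsLinearMap ℝ fun y : κ ⊕ ι → ℝ => fun l => y (Sum.inl l) := ⟨fun _ _ => rfl,
    fun _ _ => rfl⟩
  have hconv : Convex ℝ ((fun y : κ ⊕ ι → ℝ => fun l => y (Sum.inl l)) ⁻¹' stdSimplex ℝ κ) :=
    (convex_stdSimplex ℝ κ).is_linear_preimage hlin
  refine convexHull_min ?_ hconv hy
  intro y hy
  obtain ⟨i, x, hx, rfl⟩ := Set.mem_iUnion.mp hy
  exact single_mem_stdSimplex ℝ i

section Cayley
variable {σ ι κ : Type*} [Fintype σ] [Fintype ι] [Fintype κ] [DecidableEq κ]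

theorem affineSpan_latticeHull {v : σ → ι → ℤ} (hv : IsLatticeSimplex v)
    (hc : Fintype.card σ = Fintype.card ι + 1) : affineSpan ℝ (latticeHull v) = ⊤ := by
  obtain ⟨B, hB⟩ := hv.exists_affineBasis hc
  rw [latticeHull, affineSpan_convexHull, ← funext hB]
  exact B.tot

/-- The first coordinates of a Cayley polytope of `d` polytopes are nonnegative lattice functions
on it with sum `1`, and none of them vanishes identically. At an interior lattice point of the
`k`-th dilate they are therefore positive integers with sum `k`, which forces `k ≥ d`. -/
theorem IsFacetBasic.hasConstantHeight_of_latticeIsomorphic_cayley {v : σ → ι → ℤ}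
    (hv : IsLatticeSimplex v) (hc : Fintype.card σ = Fintype.card ι + 1) (hF : IsFacetBasic v)
    (hd : Fintype.card σ = 2 * Fintype.card κ) (S : κ → Set (κ → ℝ))
    (hS : ∀ i, (S i).Nonempty) (hiso : LatticeIsomorphic (latticeHull v) (cayley S)) :
    HasConstantHeight v (Fintype.card κ) := by
  obtain ⟨φ, -, himg, hlat⟩ := hiso
  rw [affineSpan_latticeHull hv hc] at hlat
  have hint : ∀ z : ι → ℤ, ∃ z' : κ ⊕ κ → ℤ, φ (realVec z) = realVec z' := fun z => by
    obtain ⟨z', hz'⟩ := (hlat.subset ⟨_, ⟨by simp, z, rfl⟩, rfl⟩).2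
    exact ⟨z', hz'.symm⟩
  have hvert : ∀ i, φ (realVec (v i)) ∈ cayley S := fun i =>
    himg ▸ Set.mem_image_of_mem φ (subset_convexHull ℝ _ ⟨i, rfl⟩)
  have hsplx := fun i => cayley_subset_stdSimplex S (hvert i)
  -- each of the first coordinates is positive at some vertex
  have hpos : ∀ l : κ, ∃ i, 0 < φ (realVec (v i)) (Sum.inl l) := by
    intro l
    by_contra! hle
    have hsub : cayley S ⊆ {y | y (Sum.inl l) ≤ 0} := by
      rw [← himg, latticeHull, φ.image_convexHull]
      refine convexHull_min ?_ (convex_halfSpace_le ⟨fun _ _ => rfl, fun _ _ => rfl⟩ 0)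
      rintro _ ⟨_, ⟨i, rfl⟩, rfl⟩
      exact hle i
    obtain ⟨p, hp⟩ := hS l
    have h1 := hsub (subset_convexHull ℝ _ (Set.mem_iUnion.mpr ⟨l, p, hp, rfl⟩))
    simp only [Set.mem_ofPred_eq, Sum.elim_inl, Pi.single_eq_same] at h1
    linarith
  have hne : Nonempty σ := by
    rw [← Fintype.card_pos_iff]
    lia
  obtain ⟨i₀⟩ := hne
  -- the first coordinates are integral on the coefficient lattice
  have hinteg : ∀ x ∈ coeffLattice v, ∀ l : κ,
      ∃ m : ℤ, ∑ i, x i * φ (realVec (v i)) (Sum.inl l) = m := by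
    rintro x ⟨⟨k, hk⟩, y, hy⟩ l
    obtain ⟨z, hz⟩ := hint (y - (k - 1) • v i₀)
    obtain ⟨z₀, hz₀⟩ := hint (v i₀)
    have hφ : ∀ w, φ w = φ.linear w + φ 0 := fun w => congrFun φ.decomp w
    have h1 : ∑ i, x i • φ (realVec (v i)) = realVec z + ((k : ℝ) - 1) • realVec z₀ := by
      simp_rw [hφ (realVec (v _)), smul_add]
      rw [Finset.sum_add_distrib, ← Finset.sum_smul, hk]
      simp_rw [← map_smul]
      rw [← map_sum, hy, ← hz, ← hz₀, hφ (realVec (v i₀)), hφ (realVec (_ - _)), realVec_sub,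
        realVec_zsmul, map_sub, map_smul]
      push_cast
      module
    refine ⟨z (Sum.inl l) + (k - 1) * z₀ (Sum.inl l), ?_⟩
    have h2 := congrFun h1 (Sum.inl l)
    simp only [Finset.sum_apply, Pi.smul_apply, smul_eq_mul, Pi.add_apply] at h2
    rw [h2]
    simp [realVec]
  refine hF.hasConstantHeight_of_le hd fun x hx hx1 => ?_
  have hone : ∀ l : κ, (1 : ℝ) ≤ ∑ i, x i * φ (realVec (v i)) (Sum.inl l) := by
    intro l
    obtain ⟨i, hi⟩ := hpos l
    have h0 : 0 < ∑ i, x i * φ (realVec (v i)) (Sum.inl l) :=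
      Finset.sum_pos' (fun i _ => mul_nonneg (hx1 i).1.le ((hsplx i).1 l))
        ⟨i, Finset.mem_univ i, mul_pos (hx1 i).1 hi⟩
    obtain ⟨m, hm⟩ := hinteg x hx l
    rw [hm] at h0 ⊢
    exact_mod_cast h0
  have h2 := Finset.sum_le_sum fun l (_ : l ∈ Finset.univ) => hone l
  rw [Finset.sum_comm, Finset.sum_const, Finset.card_univ, nsmul_one] at h2
  refine h2.trans_eq (Finset.sum_congr rfl fun i _ => ?_)
  rw [← Finset.mul_sum, (hsplx i).2, mul_one]

end Cayley

/-! ### The `h^*`-polynomial -/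

section Generator
variable {σ ι : Type*} [Fintype σ]

/-- `u` generates the coefficient lattice modulo `ℤ^σ`, where its class has order `n`; moreover
`u_j = 1 / n`. -/
structure IsCoeffGenerator (v : σ → ι → ℤ) (j : σ) (n : ℕ) (u : σ → ℝ) : Prop where
  pos : 0 < n
  mem : u ∈ coeffLattice v
  apply_eq : u j = 1 / n
  exists_eq : ∀ x ∈ coeffLattice v, ∃ (m : ℤ) (z : σ → ℤ), x = m • u + realVec z

/-- The representative in the half-open unit cube of the class of `g u`. -/
noncomputable def cubeRep (u : σ → ℝ) (g : ℕ) : σ → ℝ := fun i => Int.fract (g * u i)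

variable {v : σ → ι → ℤ} {j : σ} {n : ℕ} {u : σ → ℝ}

theorem IsCoeffGenerator.exists_nsmul_eq (hu : IsCoeffGenerator v j n u) (hF : IsFacetBasic v) :
    ∃ b : σ → ℤ, ∀ i, n * u i = b i := by
  have hn : (n : ℝ) ≠ 0 := Nat.cast_ne_zero.mpr hu.pos.ne'
  obtain ⟨b, hb⟩ := hF _ (nsmul_mem hu.mem n) j ⟨1, by
    simp [hu.apply_eq, hn]⟩
  exact ⟨b, fun i => by simpa [realVec] using congrFun hb i⟩

theorem IsCoeffGenerator.cubeRep_mem (hu : IsCoeffGenerator v j n u) (g : ℕ) :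
    cubeRep u g ∈ coeffLattice v := by
  convert fract_mem_coeffLattice (nsmul_mem hu.mem g) using 1
  ext i
  rw [cubeRep, Pi.smul_apply, nsmul_eq_mul]

theorem IsCoeffGenerator.cubeRep_apply (hu : IsCoeffGenerator v j n u) {g : ℕ} (hg : g < n) :
    cubeRep u g j = g / n := by
  have hn : (0 : ℝ) < n := Nat.cast_pos.mpr hu.pos
  rw [cubeRep, hu.apply_eq, mul_one_div, Int.fract_eq_self]
  exact ⟨by positivity, by rw [div_lt_one hn]; exact_mod_cast hg⟩

theorem IsCoeffGenerator.cubeRep_ne_zero (hu : IsCoeffGenerator v j n u) {g : ℕ} (hg : g < n)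
    (hg0 : g ≠ 0) : cubeRep u g ≠ 0 := by
  intro h
  have := congrFun h j
  rw [hu.cubeRep_apply hg] at this
  have hn : (n : ℝ) ≠ 0 := Nat.cast_ne_zero.mpr hu.pos.ne'
  simp [hn, hg0] at this

theorem IsCoeffGenerator.exists_fract_eq_cubeRep (hu : IsCoeffGenerator v j n u)
    (hF : IsFacetBasic v) {x : σ → ℝ} (hx : x ∈ coeffLattice v) :
    ∃ g < n, (fun i => Int.fract (x i)) = cubeRep u g := by
  obtain ⟨m, z, rfl⟩ := hu.exists_eq x hx
  obtain ⟨b, hb⟩ := hu.exists_nsmul_eq hF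
  have hn : (n : ℤ) ≠ 0 := Nat.cast_ne_zero.mpr hu.pos.ne'
  refine ⟨(m % n).toNat, ?_, ?_⟩
  · have := Int.emod_lt_of_pos m (Nat.cast_pos.mpr hu.pos : (0 : ℤ) < n)
    lia
  · ext i
    rw [cubeRep, Int.fract_eq_fract]
    refine ⟨z i + (m / n) * b i, ?_⟩
    have h1 : (((m % n).toNat : ℕ) : ℝ) = m - n * ((m / n : ℤ) : ℝ) := by
      have : (((m % n).toNat : ℕ) : ℤ) = m - n * (m / n) := by
        rw [Int.toNat_of_nonneg (Int.emod_nonneg _ hn), Int.emod_def]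
      exact_mod_cast this
    rw [h1, Pi.add_apply, Pi.smul_apply, zsmul_eq_mul, realVec]
    push_cast
    rw [← hb i]
    ring

theorem IsCoeffGenerator.exists_eq_cubeRep (hu : IsCoeffGenerator v j n u)
    (hF : IsFacetBasic v) {x : σ → ℝ} (hx : x ∈ coeffLattice v)
    (hx1 : ∀ i, x i ∈ Set.Ico (0 : ℝ) 1) : ∃ g < n, x = cubeRep u g := by
  obtain ⟨g, hg, h⟩ := hu.exists_fract_eq_cubeRep hF hx
  exact ⟨g, hg, by rw [← h]; ext i; exact (Int.fract_eq_self.mpr (hx1 i)).symm⟩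

theorem IsCoeffGenerator.exists_height (hu : IsCoeffGenerator v j n u) :
    ∃ H : ℕ → ℕ, ∀ g, ∑ i, cubeRep u g i = H g := by
  have : ∀ g, ∃ k : ℕ, ∑ i, cubeRep u g i = k := fun g => by
    obtain ⟨⟨k, hk⟩, -⟩ := hu.cubeRep_mem g
    have h0 : 0 ≤ ∑ i, cubeRep u g i := Finset.sum_nonneg fun i _ => Int.fract_nonneg _
    rw [hk] at h0
    norm_cast at h0
    lift k to ℕ using h0
    exact ⟨k, hk⟩
  choose H hH using this
  exact ⟨H, hH⟩

end Generator

theorem zero_smul_latticeHull {σ ι : Type*} [Nonempty σ] (v : σ → ι → ℤ) :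
    (0 : ℝ) • latticeHull v = {0} := by
  rw [Set.zero_smul_set, Set.singleton_zero]
  exact (Set.range_nonempty _).convexHull

theorem coeff_ehrhartSeries_latticeHull {σ ι : Type*} [Nonempty σ] (v : σ → ι → ℤ)
    (k : ℕ) : PowerSeries.coeff k (ehrhartSeries (latticeHull v)) = ehrhartCount (latticeHull v) k := by
  rw [ehrhartSeries, PowerSeries.coeff_mk]
  split_ifs with hk
  · have : {z : ι → ℤ | realVec z ∈ ((0 : ℕ) : ℝ) • latticeHull v} = {0} := by
      ext z
      rw [Set.mem_ofPred_eq, Nat.cast_zero, zero_smul_latticeHull, Set.mem_singleton_iff,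
        Set.mem_singleton_iff, ← realVec_zero]
      exact realVec_injective.eq_iff
    rw [hk, ehrhartCount, this, Set.ncard_singleton, Nat.cast_one]
  · rfl

section Ehrhart
variable {σ ι : Type*} [Fintype σ] [Fintype ι]
  {v : σ → ι → ℤ} {j : σ} {n : ℕ} {u : σ → ℝ}

theorem mem_natCast_smul_latticeHull_iff (hv : IsLatticeSimplex v)
    (hc : Fintype.card σ = Fintype.card ι + 1) {k : ℕ} {w : ι → ℝ} :
    w ∈ (k : ℝ) • latticeHull v ↔
      ∃ x : σ → ℝ, (∀ i, 0 ≤ x i) ∧ ∑ i, x i = k ∧ ∑ i, x i • realVec (v i) = w := by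
  rcases Nat.eq_zero_or_pos k with rfl | hk
  · have : Nonempty σ := Fintype.card_pos_iff.mp (by lia)
    rw [Nat.cast_zero, zero_smul_latticeHull, Set.mem_singleton_iff]
    constructor
    · rintro rfl
      exact ⟨0, by simp⟩
    · rintro ⟨x, hx0, hx1, rfl⟩
      rw [Finset.sum_eq_zero_iff_of_nonneg fun i _ => hx0 i] at hx1
      exact Finset.sum_eq_zero fun i hi => by rw [hx1 i hi, zero_smul]
  · exact mem_smul_latticeHull_iff hv hc (by exact_mod_cast hk)

/-- The lattice points of `kΔ` correspond to the pairs of a class `g` modulo `ℤ^σ` and a vector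
`c ∈ ℕ^σ` with sum `k - H g`, by splitting the coefficients into fractional and integral parts. -/
theorem IsCoeffGenerator.ehrhartCount_eq [DecidableEq σ] (hu : IsCoeffGenerator v j n u)
    (hv : IsLatticeSimplex v) (hc : Fintype.card σ = Fintype.card ι + 1) (hF : IsFacetBasic v)
    {H : ℕ → ℕ} (hH : ∀ g, ∑ i, cubeRep u g i = H g) (k : ℕ) :
    ehrhartCount (latticeHull v) k = ∑ g ∈ Finset.range n,
      if H g ≤ k then (Finset.finsuppAntidiag (Finset.univ : Finset σ) (k - H g)).card else 0 := by
  have hmem : ∀ (g : ℕ) (c : σ →₀ ℕ), (cubeRep u g + realVec fun i => (c i : ℤ)) ∈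
      coeffLattice v := fun g c => add_mem (hu.cubeRep_mem g) (realVec_mem_coeffLattice v _)
  choose Ψ hΨ using fun g c => (hmem g c).2
  let T : Finset ((_ : ℕ) × (σ →₀ ℕ)) := (Finset.range n).sigma fun g =>
    if H g ≤ k then Finset.finsuppAntidiag Finset.univ (k - H g) else ∅
  have hT : ∀ p : (_ : ℕ) × (σ →₀ ℕ), p ∈ T ↔ p.1 < n ∧ H p.1 + ∑ i, p.2 i = k := by
    intro p
    rw [Finset.mem_sigma, Finset.mem_range]
    refine and_congr_right fun _ => ?_
    split_ifs with h
    · rw [Finset.mem_finsuppAntidiag]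
      simp only [Finset.subset_univ, and_true]
      lia
    · simp only [Finset.notMem_empty, false_iff]
      lia
  have hsum : ∀ (g : ℕ) (c : σ →₀ ℕ),
      ∑ i, (cubeRep u g + realVec fun i => (c i : ℤ)) i = (H g + ∑ i, c i : ℕ) := by
    intro g c
    simp only [Pi.add_apply, Finset.sum_add_distrib, hH, realVec]
    push_cast
    rfl
  have himg : {z : ι → ℤ | realVec z ∈ (k : ℝ) • latticeHull v} =
      (fun p : (_ : ℕ) × (σ →₀ ℕ) => Ψ p.1 p.2) '' T := by
    ext z
    rw [Set.mem_ofPred_eq, mem_natCast_smul_latticeHull_iff hv hc]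
    constructor
    · rintro ⟨x, hx0, hx1, hx2⟩
      have hxL : x ∈ coeffLattice v := ⟨⟨k, by exact_mod_cast hx1⟩, z, hx2⟩
      obtain ⟨g, hg, hgx⟩ := hu.exists_fract_eq_cubeRep hF hxL
      let c : σ →₀ ℕ := Finsupp.equivFunOnFinite.symm fun i => ⌊x i⌋.toNat
      have hxc : (cubeRep u g + realVec fun i => (c i : ℤ)) = x := by
        ext i
        have : ((c i : ℕ) : ℤ) = ⌊x i⌋ := Int.toNat_of_nonneg (Int.floor_nonneg.mpr (hx0 i))
        rw [← hgx, Pi.add_apply, realVec, this, Int.fract_add_floor]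
      refine ⟨⟨g, c⟩, (hT _).mpr ⟨hg, ?_⟩, ?_⟩
      · have := hsum g c
        rw [hxc, hx1] at this
        exact_mod_cast this.symm
      · apply realVec_injective
        rw [← hΨ, hxc, hx2]
    · rintro ⟨⟨g, c⟩, hp, rfl⟩
      refine ⟨_, fun i => ?_, ?_, hΨ g c⟩
      · exact add_nonneg (Int.fract_nonneg _) (by simp [realVec])
      · rw [hsum, ((hT _).mp hp).2]
  have hinj : Set.InjOn (fun p : (_ : ℕ) × (σ →₀ ℕ) => Ψ p.1 p.2) T := by
    rintro ⟨g, c⟩ hp ⟨g', c'⟩ hp' h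
    have h1 := (hT _).mp hp
    have h2 := (hT _).mp hp'
    have heq := hv.eq_of_sum_eq ((hsum g c).trans ((hsum g' c').trans (by rw [h1.2, h2.2])).symm)
      ((hΨ g c).trans ((congrArg realVec h).trans (hΨ g' c').symm))
    have hfr : ∀ (g : ℕ) (c : σ →₀ ℕ) (i : σ),
        Int.fract ((cubeRep u g + realVec fun i => (c i : ℤ)) i) = cubeRep u g i := fun g c i => by
      rw [Pi.add_apply, realVec, Int.fract_add_intCast, cubeRep, Int.fract_fract]
    have hrep : ∀ i, cubeRep u g i = cubeRep u g' i := fun i => by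
      rw [← hfr g c, heq, hfr]
    have hg : g = g' := by
      have := hrep j
      rw [hu.cubeRep_apply h1.1, hu.cubeRep_apply h2.1] at this
      have hn : (n : ℝ) ≠ 0 := Nat.cast_ne_zero.mpr hu.pos.ne'
      exact_mod_cast (div_left_inj' hn).mp this
    subst hg
    have hcc : c = c' := by
      ext i
      have := congrFun (add_left_cancel heq) i
      simp only [realVec] at this
      exact_mod_cast this
    rw [hcc]
  rw [ehrhartCount, himg, hinj.ncard_image, Set.ncard_coe_finset, Finset.card_sigma]
  exact Finset.sum_congr rfl fun g _ => by split_ifs <;> simp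

/-- The `h^*`-polynomial counts the classes of the coefficient lattice modulo `ℤ^σ` by height. -/
theorem IsCoeffGenerator.hStar_eq {m : ℕ} {v : σ → Fin m → ℤ} (hu : IsCoeffGenerator v j n u)
    (hv : IsLatticeSimplex v) (hc : Fintype.card σ = m + 1) (hF : IsFacetBasic v)
    {H : ℕ → ℕ} (hH : ∀ g, ∑ i, cubeRep u g i = H g) :
    hStar (latticeHull v) = ∑ g ∈ Finset.range n, PowerSeries.X ^ H g := by
  classical
  have : Nonempty σ := ⟨j⟩
  have hE : ehrhartSeries (latticeHull v) =
      (∑ g ∈ Finset.range n, PowerSeries.X ^ H g) * (PowerSeries.mk 1) ^ (m + 1) := by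
    ext k
    rw [coeff_ehrhartSeries_latticeHull, hu.ehrhartCount_eq hv (by simpa using hc) hF hH,
      Finset.sum_mul, map_sum, Nat.cast_sum]
    refine Finset.sum_congr rfl fun g _ => ?_
    rw [PowerSeries.coeff_X_pow_mul', ← hc, ← Finset.card_univ, ← Finset.prod_const,
      PowerSeries.coeff_prod]
    split_ifs <;> simp
  rw [hStar, hE, mul_comm, mul_assoc, ← mul_pow, PowerSeries.mk_one_mul_one_sub_eq_one, one_pow,
    mul_one]

theorem hasConstantHeight_iff_hStar {m : ℕ} {v : σ → Fin m → ℤ} (hu : IsCoeffGenerator v j n u)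
    (hv : IsLatticeSimplex v) (hc : Fintype.card σ = m + 1) (hF : IsFacetBasic v) {d : ℕ}
    (hd : Fintype.card σ = 2 * d) :
    (∃ n : ℤ, 1 ≤ n ∧ hStar (latticeHull v) = 1 + PowerSeries.C (n - 1) * PowerSeries.X ^ d) ↔
      HasConstantHeight v d := by
  obtain ⟨H, hH⟩ := hu.exists_height
  have hn := hu.pos
  constructor
  · rintro ⟨N, -, hN⟩
    rw [hu.hStar_eq hv hc hF hH] at hN
    refine hF.hasConstantHeight_of_le hd fun x hx hx1 => ?_
    obtain ⟨g, hg, rfl⟩ := hu.exists_eq_cubeRep hF hx fun i => ⟨(hx1 i).1.le, (hx1 i).2⟩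
    have hpos : 0 < ∑ i, cubeRep u g i :=
      Finset.sum_pos (fun i _ => (hx1 i).1) ⟨j, Finset.mem_univ j⟩
    rw [hH] at hpos ⊢
    norm_cast at hpos ⊢
    by_contra! hlt
    -- the coefficient of `X ^ H g` is at least `1` on the left and `0` on the right
    have h1 := congrArg (PowerSeries.coeff (H g)) hN
    rw [map_add, PowerSeries.coeff_one, if_neg hpos.ne', PowerSeries.coeff_C_mul,
      PowerSeries.coeff_X_pow, if_neg hlt.ne, mul_zero, add_zero, map_sum] at h1
    simp_rw [PowerSeries.coeff_X_pow] at h1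
    rw [Finset.sum_eq_zero_iff_of_nonneg fun i _ => by split_ifs <;> simp] at h1
    simpa using h1 g (Finset.mem_range.mpr hg)
  · intro h
    refine ⟨n, by exact_mod_cast hn, ?_⟩
    rw [hu.hStar_eq hv hc hF hH]
    obtain ⟨n', rfl⟩ : ∃ n', n = n' + 1 := ⟨n - 1, by lia⟩
    have h0 : H 0 = 0 := by
      have := hH 0
      simpa [cubeRep, eq_comm] using this
    have hg : ∀ g < n' + 1, g ≠ 0 → H g = d := fun g hg hg0 => by
      have := h _ (hu.cubeRep_mem g) (fun i => ⟨Int.fract_nonneg _, Int.fract_lt_one _⟩)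
        (hu.cubeRep_ne_zero hg hg0)
      rw [hH] at this
      exact_mod_cast this
    rw [Finset.sum_range_succ', h0, pow_zero, add_comm]
    congr 1
    rw [Finset.sum_congr rfl fun g hg' => by
      rw [hg (g + 1) (by have := Finset.mem_range.mp hg'; lia) (by lia)]]
    simp

end Ehrhart

/-! ### Constant height and pairs of vertices -/

section Pairing
variable {σ ι : Type*} [Fintype σ] {v : σ → ι → ℤ} {j : σ} {n : ℕ} {u : σ → ℝ}

theorem IsCoeffGenerator.isCoprime (hu : IsCoeffGenerator v j n u) (hF : IsFacetBasic v)
    {b : σ → ℤ} (hb : ∀ i, n * u i = b i) (i : σ) : IsCoprime (b i) n := by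
  obtain ⟨n', hn'⟩ := Int.gcd_dvd_right (b i) n
  obtain ⟨b', hb'⟩ := Int.gcd_dvd_left (b i) n
  rw [Int.isCoprime_iff_gcd_eq_one]
  set g := Int.gcd (b i) n
  have hnr : (n : ℝ) ≠ 0 := Nat.cast_ne_zero.mpr hu.pos.ne'
  have hn2 : (n : ℝ) = g * n' := by exact_mod_cast hn'
  have hb2 : (b i : ℝ) = g * b' := by exact_mod_cast hb'
  have hg0 : (g : ℝ) ≠ 0 := by
    intro h
    rw [h, zero_mul] at hn2
    exact hnr hn2
  have hn0 : (n' : ℝ) ≠ 0 := by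
    intro h
    rw [h, mul_zero] at hn2
    exact hnr hn2
  obtain ⟨z, hz⟩ := hF _ (zsmul_mem hu.mem n') i ⟨b', by
    rw [Pi.smul_apply, zsmul_eq_mul]
    apply mul_left_cancel₀ hg0
    rw [← hb2, ← hb, hn2]
    ring⟩
  have h1 := congrFun hz j
  rw [Pi.smul_apply, zsmul_eq_mul, hu.apply_eq, hn2, realVec] at h1
  have h2 : (g : ℝ) * z j = 1 := by
    rw [← h1]
    field_simp
  have h3 : (g : ℤ) * z j = 1 := by exact_mod_cast h2
  exact_mod_cast Int.eq_one_of_mul_eq_one_right (by positivity) h3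

/-- If all nonzero classes have height `d`, then the coordinates can be grouped into pairs with
integral sums. This is the number-theoretic heart of the argument. -/
theorem HasConstantHeight.exists_pairing {d : ℕ} {v : Fin (2 * d) → ι → ℤ} {j : Fin (2 * d)}
    {u : Fin (2 * d) → ℝ} (h : HasConstantHeight v d)
    (hu : IsCoeffGenerator v j n u) (hF : IsFacetBasic v) :
    ∃ e : Fin d ⊕ Fin d ≃ Fin (2 * d), ∀ x ∈ coeffLattice v, ∀ i,
      ∃ m : ℤ, x (e (Sum.inl i)) + x (e (Sum.inr i)) = m := by
  have : NeZero n := ⟨hu.pos.ne'⟩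
  have hnr : (n : ℝ) ≠ 0 := NeZero.ne _
  obtain ⟨b, hb⟩ := hu.exists_nsmul_eq hF
  have hcop := hu.isCoprime hF hb
  have hfract : ∀ m : ℤ, ¬ (n : ℤ) ∣ m → ∑ i, Int.fract ((m * b i : ℤ) / (n : ℝ)) = d := by
    intro m hm
    have hmul : ∀ i, ((m * b i : ℤ) / (n : ℝ)) = (m • u) i := fun i => by
      rw [Pi.smul_apply, zsmul_eq_mul, Int.cast_mul, ← hb]
      field_simp
    simp_rw [hmul]
    refine h _ (fract_mem_coeffLattice (zsmul_mem hu.mem m))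
      (fun i => ⟨Int.fract_nonneg _, Int.fract_lt_one _⟩) fun h0 => hm ?_
    have h1 : Int.fract ((m • u) j) = 0 := congrFun h0 j
    rw [Pi.smul_apply, zsmul_eq_mul, hu.apply_eq, mul_one_div] at h1
    have h2 := Int.floor_add_fract ((m : ℝ) / n)
    rw [h1, add_zero, eq_div_iff hnr] at h2
    exact ⟨⌊(m : ℝ) / n⌋, by rw [mul_comm]; exact_mod_cast h2.symm⟩
  obtain ⟨e, he⟩ := exists_equiv_sum_of_card_eq_card_neg (b := fun i => (b i : ZMod n))
    (fun i => by rw [ZMod.coe_int_isUnit_iff_isCoprime, isCoprime_comm]; exact hcop i)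
    (fun w hw => card_eq_card_neg_of_sum_fract_const hcop hfract hw)
  refine ⟨e, fun x hx i => ?_⟩
  obtain ⟨m, z, rfl⟩ := hu.exists_eq x hx
  have h1 := he i
  rw [eq_neg_iff_add_eq_zero, ← Int.cast_add, ZMod.intCast_zmod_eq_zero_iff_dvd] at h1
  obtain ⟨t, ht⟩ := h1
  have ht' : (b (e (Sum.inl i)) : ℝ) + b (e (Sum.inr i)) = n * t := by exact_mod_cast ht
  rw [← hb, ← hb, ← mul_add] at ht'
  have h2 := mul_left_cancel₀ hnr ht'
  refine ⟨m * t + z (e (Sum.inl i)) + z (e (Sum.inr i)), ?_⟩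
  push_cast
  rw [← h2, Pi.add_apply, Pi.add_apply, Pi.smul_apply, Pi.smul_apply, zsmul_eq_mul, zsmul_eq_mul,
    realVec, realVec]
  ring

end Pairing

/-! ### Reindexing the vertices -/

theorem latticeHull_comp_equiv {σ τ ι : Type*} {v : σ → ι → ℤ} (e : τ ≃ σ) :
    latticeHull (v ∘ e) = latticeHull v :=
  congrArg (convexHull ℝ) (e.surjective.range_comp fun i => realVec (v i))

section Reindex
variable {σ τ ι : Type*} [Fintype σ] [Fintype τ] {v : σ → ι → ℤ}

theorem comp_mem_coeffLattice (e : τ ≃ σ) {x : σ → ℝ} (hx : x ∈ coeffLattice v) :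
    x ∘ e ∈ coeffLattice (v ∘ e) := by
  obtain ⟨⟨k, hk⟩, y, hy⟩ := hx
  exact ⟨⟨k, (e.sum_comp x).trans hk⟩, y, (e.sum_comp fun i => x i • realVec (v i)).trans hy⟩

theorem comp_symm_mem_coeffLattice (e : τ ≃ σ) {x : τ → ℝ} (hx : x ∈ coeffLattice (v ∘ e)) :
    x ∘ e.symm ∈ coeffLattice v := by
  simpa [Function.comp_assoc] using comp_mem_coeffLattice e.symm hx

theorem IsCoeffGenerator.comp_equiv (e : τ ≃ σ) {j : τ} {n : ℕ} {u : σ → ℝ}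
    (hu : IsCoeffGenerator v (e j) n u) : IsCoeffGenerator (v ∘ e) j n (u ∘ e) where
  pos := hu.pos
  mem := comp_mem_coeffLattice e hu.mem
  apply_eq := hu.apply_eq
  exists_eq := fun x hx => by
    obtain ⟨m, z, h⟩ := hu.exists_eq _ (comp_symm_mem_coeffLattice e hx)
    refine ⟨m, z ∘ e, ?_⟩
    ext i
    have := congrFun h (e i)
    rw [Function.comp_apply, e.symm_apply_apply] at this
    exact this

theorem IsFacetBasic.comp_equiv (e : τ ≃ σ) (hF : IsFacetBasic v) : IsFacetBasic (v ∘ e) := by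
  intro x hx j hj
  obtain ⟨z, hz⟩ := hF _ (comp_symm_mem_coeffLattice e hx) (e j) (by simpa using hj)
  refine ⟨z ∘ e, ?_⟩
  ext i
  have := congrFun hz (e i)
  rw [Function.comp_apply, e.symm_apply_apply] at this
  exact this

end Reindex

/-! ### Simplices with the same coefficient lattice -/

/-- A full-dimensional lattice simplex is isomorphic to every lattice simplex with the same
coefficient lattice. -/
theorem latticeIsomorphic_of_coeffLattice_eq {σ ι κ : Type*} [Fintype σ] [Fintype ι]
    {v : σ → ι → ℤ} {w : σ → κ → ℤ} (hv : IsLatticeSimplex v) (hw : IsLatticeSimplex w)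
    (hc : Fintype.card σ = Fintype.card ι + 1) (h : coeffLattice v = coeffLattice w) :
    LatticeIsomorphic (latticeHull v) (latticeHull w) := by
  classical
  obtain ⟨B, hB⟩ := hv.exists_affineBasis hc
  let φ : (ι → ℝ) →ᵃ[ℝ] (κ → ℝ) :=
    { toFun := fun y => ∑ i, B.coord i y • realVec (w i)
      linear := ∑ i, (B.coord i).linear.smulRight (realVec (w i))
      map_vadd' := fun p y => by
        simp_rw [AffineMap.map_vadd, vadd_eq_add, add_smul, Finset.sum_add_distrib,
          LinearMap.sum_apply, LinearMap.smulRight_apply] }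
  have hφ : ∀ y, φ y = ∑ i, B.coord i y • realVec (w i) := fun _ => rfl
  have hvert : ∀ i, φ (realVec (v i)) = realVec (w i) := fun i => by
    rw [hφ, ← hB, Finset.sum_eq_single i]
    · rw [B.coord_apply_eq, one_smul]
    · intro l _ hl
      rw [B.coord_apply_ne hl, zero_smul]
    · simp
  have himg : φ '' latticeHull v = latticeHull w := by
    rw [latticeHull, φ.image_convexHull, ← Set.range_comp, latticeHull]
    simp only [Function.comp_def, hvert]
  have hint : ∀ y, y ∈ Set.range realVec ↔ φ y ∈ Set.range realVec := by
    intro y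
    have h1 := B.sum_coord_apply_eq_one y
    have hy := B.linear_combination_coord_eq_self y
    simp_rw [hB] at hy
    constructor
    · rintro ⟨z, rfl⟩
      have hmem : (fun i => B.coord i (realVec z)) ∈ coeffLattice v :=
        ⟨⟨1, by simp [h1]⟩, z, hy⟩
      rw [h] at hmem
      obtain ⟨z', hz'⟩ := hmem.2
      exact ⟨z', hz'.symm⟩
    · rintro ⟨z', hz'⟩
      have hmem : (fun i => B.coord i y) ∈ coeffLattice w :=
        ⟨⟨1, by simp [h1]⟩, z', hz'.symm⟩
      rw [← h] at hmem
      obtain ⟨z, hz⟩ := hmem.2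
      exact ⟨z, hz.symm.trans hy⟩
  refine ⟨φ, fun y _ y' _ hyy => B.ext_elem fun i => ?_, himg, ?_⟩
  · exact congrFun (hw.eq_of_sum_eq (by simp [B.sum_coord_apply_eq_one]) hyy) i
  · rw [← himg, ← AffineSubspace.map_span, AffineSubspace.coe_map, affineSpan_latticeHull hv hc]
    ext y
    constructor
    · rintro ⟨x, ⟨hx, hx'⟩, rfl⟩
      exact ⟨⟨x, hx, rfl⟩, (hint x).mp hx'⟩
    · rintro ⟨⟨x, hx, rfl⟩, hx'⟩
      exact ⟨x, ⟨hx, (hint x).mpr hx'⟩, rfl⟩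

/-! ### Cayley polytopes of segments -/

section CayleySegments
variable {κ ι : Type*} [DecidableEq κ]

/-- The vertices of the Cayley polytope of the segments `conv(p_i, q_i)`. -/
def cayleyVertex (p q : κ → ι → ℤ) : κ ⊕ κ → κ ⊕ ι → ℤ :=
  Sum.elim (fun i => Sum.elim (Pi.single i 1) (p i)) (fun i => Sum.elim (Pi.single i 1) (q i))

theorem realVec_sumElim_single (i : κ) (p : ι → ℤ) :
    realVec (Sum.elim (Pi.single i 1) p : κ ⊕ ι → ℤ) = Sum.elim (Pi.single i 1) (realVec p) := by
  ext (l | l)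
  · simp [realVec, Pi.single_apply]
  · rfl

theorem cayley_segment (p q : κ → ι → ℤ) :
    (cayley fun i => segment ℝ (realVec (p i)) (realVec (q i))) =
      latticeHull (cayleyVertex p q) := by
  apply Set.Subset.antisymm
  · refine convexHull_min ?_ (convex_convexHull ℝ _)
    refine Set.iUnion_subset fun i => ?_
    rintro _ ⟨_, ⟨s, t, hs, ht, hst, rfl⟩, rfl⟩
    have h1 : realVec (cayleyVertex p q (Sum.inl i)) ∈ latticeHull (cayleyVertex p q) :=
      subset_convexHull ℝ _ ⟨_, rfl⟩
    have h2 : realVec (cayleyVertex p q (Sum.inr i)) ∈ latticeHull (cayleyVertex p q) :=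
      subset_convexHull ℝ _ ⟨_, rfl⟩
    have h3 := (convex_convexHull ℝ _) h1 h2 hs ht hst
    have h4 : (Sum.elim (Pi.single i 1) (s • realVec (p i) + t • realVec (q i)) : κ ⊕ ι → ℝ) =
        s • realVec (cayleyVertex p q (Sum.inl i)) +
          t • realVec (cayleyVertex p q (Sum.inr i)) := by
      simp only [cayleyVertex, Sum.elim_inl, Sum.elim_inr, realVec_sumElim_single]
      ext (l | l)
      · simp only [Sum.elim_inl, Pi.add_apply, Pi.smul_apply, smul_eq_mul]
        rw [← add_mul, hst, one_mul]
      · simp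
    rw [← h4] at h3
    exact h3
  · refine convexHull_min ?_ (convex_convexHull ℝ _)
    rintro _ ⟨i | i, rfl⟩ <;> refine subset_convexHull ℝ _ (Set.mem_iUnion.mpr ⟨i, ?_⟩)
    · exact ⟨_, left_mem_segment ℝ _ _, (realVec_sumElim_single _ _).symm⟩
    · exact ⟨_, right_mem_segment ℝ _ _, (realVec_sumElim_single _ _).symm⟩

theorem sum_smul_cayleyVertex_inl [Fintype κ] (p q : κ → ι → ℤ) (x : κ ⊕ κ → ℝ) (l : κ) :
    (∑ i, x i • realVec (cayleyVertex p q i)) (Sum.inl l) = x (Sum.inl l) + x (Sum.inr l) := by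
  simp [Fintype.sum_sum_type, cayleyVertex, realVec_sumElim_single, Finset.sum_apply,
    Pi.single_apply]

theorem sum_smul_cayleyVertex_inr [Fintype κ] (p q : κ → ι → ℤ) (x : κ ⊕ κ → ℝ) (l : ι) :
    (∑ i, x i • realVec (cayleyVertex p q i)) (Sum.inr l) =
      ∑ i, (x (Sum.inl i) * p i l + x (Sum.inr i) * q i l) := by
  simp [Fintype.sum_sum_type, cayleyVertex, Finset.sum_apply, Finset.sum_add_distrib, realVec]

end CayleySegments

/-! ### The polytopes `Δ(a_1, …, a_{d-1}, n)` -/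

theorem standardCayley_eq_latticeHull {d : ℕ} (a : Fin (d - 1) → ℤ) (n : ℤ) :
    standardCayley a n = latticeHull (cayleyVertex 0 (standardEndpoint a n)) := by
  rw [← cayley_segment, standardCayley]
  simp only [Pi.zero_apply, realVec_zero]

theorem sum_mul_standardEndpoint_of_lt {d : ℕ} (a : Fin (d - 1) → ℤ) (n : ℤ) {last : Fin d}
    (hlast : last.val = d - 1) (x : Fin d → ℝ) {l : Fin d} (hl : l.val < d - 1) :
    ∑ i, x i * (standardEndpoint a n i l : ℝ) = x l + x last * a ⟨l, hl⟩ := by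
  have hne : l ≠ last := fun h => by rw [h] at hl; lia
  rw [Fintype.sum_eq_add l last hne]
  · simp [standardEndpoint, hl, hlast]
  · rintro i ⟨h1, h2⟩
    have hi : i.val < d - 1 := by
      have := i.isLt
      have : i.val ≠ last.val := fun h => h2 (Fin.ext h)
      lia
    simp [standardEndpoint, hi, Ne.symm h1]

theorem sum_mul_standardEndpoint_last {d : ℕ} (a : Fin (d - 1) → ℤ) (n : ℤ) {last : Fin d}
    (hlast : last.val = d - 1) (x : Fin d → ℝ) :
    ∑ i, x i * (standardEndpoint a n i last : ℝ) = x last * n := by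
  rw [Fintype.sum_eq_single last]
  · simp [standardEndpoint, hlast]
  · intro i h2
    have hi : i.val < d - 1 := by
      have := i.isLt
      have : i.val ≠ last.val := fun h => h2 (Fin.ext h)
      lia
    simp [standardEndpoint, hi, Ne.symm h2]

theorem isLatticeSimplex_standard {d : ℕ} (a : Fin (d - 1) → ℤ) {n : ℤ} (hn : n ≠ 0)
    {last : Fin d} (hlast : last.val = d - 1) :
    IsLatticeSimplex (cayleyVertex 0 (standardEndpoint a n)) := by
  rw [IsLatticeSimplex, affineIndependent_iff_of_fintype]
  intro x hx0 hx
  rw [Finset.univ.weightedVSub_eq_linear_combination hx0] at hx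
  have h1 : ∀ l, ∑ i, x (Sum.inr i) * (standardEndpoint a n i l : ℝ) = 0 := fun l => by
    have := congrFun hx (Sum.inr l)
    rw [sum_smul_cayleyVertex_inr] at this
    simpa using this
  have h2 : ∀ l, x (Sum.inl l) + x (Sum.inr l) = 0 := fun l => by
    have := congrFun hx (Sum.inl l)
    rw [sum_smul_cayleyVertex_inl] at this
    exact this
  have h3 : x (Sum.inr last) = 0 := by
    have := h1 last
    rw [sum_mul_standardEndpoint_last a n hlast fun i => x (Sum.inr i)] at this
    exact (mul_eq_zero.mp this).resolve_right (Int.cast_ne_zero.mpr hn)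
  have h4 : ∀ l, x (Sum.inr l) = 0 := fun l => by
    by_cases hl : l.val < d - 1
    · have := h1 l
      rw [sum_mul_standardEndpoint_of_lt a n hlast (fun i => x (Sum.inr i)) hl, h3] at this
      simpa using this
    · have : l = last := Fin.ext (by have := l.isLt; lia)
      rw [this, h3]
  rintro (l | l)
  · have := h2 l
    rwa [h4 l, add_zero] at this
  · exact h4 l

theorem mem_coeffLattice_standard_iff {d : ℕ} (a : Fin (d - 1) → ℤ) (n : ℤ) {last : Fin d}
    (hlast : last.val = d - 1) {x : Fin d ⊕ Fin d → ℝ} :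
    x ∈ coeffLattice (cayleyVertex 0 (standardEndpoint a n)) ↔
      (∀ i, ∃ m : ℤ, x (Sum.inl i) + x (Sum.inr i) = m) ∧
      (∀ (l : Fin d) (hl : l.val < d - 1),
        ∃ m : ℤ, x (Sum.inr l) + x (Sum.inr last) * a ⟨l, hl⟩ = m) ∧
      ∃ m : ℤ, x (Sum.inr last) * n = m := by
  constructor
  · rintro ⟨-, y, hy⟩
    have h1 : ∀ l, ∑ i, x (Sum.inr i) * (standardEndpoint a n i l : ℝ) = y (Sum.inr l) :=
      fun l => by
        have := congrFun hy (Sum.inr l)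
        rw [sum_smul_cayleyVertex_inr] at this
        simpa [realVec] using this
    refine ⟨fun i => ⟨y (Sum.inl i), ?_⟩, fun l hl => ⟨y (Sum.inr l), ?_⟩, y (Sum.inr last), ?_⟩
    · rw [← sum_smul_cayleyVertex_inl 0 (standardEndpoint a n), hy]
      rfl
    · rw [← h1, sum_mul_standardEndpoint_of_lt a n hlast (fun i => x (Sum.inr i)) hl]
    · rw [← h1, sum_mul_standardEndpoint_last a n hlast fun i => x (Sum.inr i)]
  · rintro ⟨h1, h2, M, hM⟩
    choose m hm using h1
    choose m' hm' using h2
    refine ⟨⟨∑ i, m i, ?_⟩, Sum.elim m fun l => if hl : l.val < d - 1 then m' l hl else M, ?_⟩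
    · rw [Fintype.sum_sum_type, ← Finset.sum_add_distrib]
      push_cast
      exact Finset.sum_congr rfl fun i _ => hm i
    · ext (l | l)
      · rw [sum_smul_cayleyVertex_inl, hm]
        rfl
      · rw [sum_smul_cayleyVertex_inr]
        simp only [Pi.zero_apply, Int.cast_zero, mul_zero, zero_add, realVec, Sum.elim_inr]
        split_ifs with hl
        · rw [sum_mul_standardEndpoint_of_lt a n hlast (fun i => x (Sum.inr i)) hl, hm']
        · have : l = last := Fin.ext (by have := l.isLt; lia)
          rw [this, sum_mul_standardEndpoint_last a n hlast fun i => x (Sum.inr i), hM]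

/-- Once the vertices are paired, the generator with last coordinate `1 / n` has the form
`x = -y`, `y = (b_1, …, b_{d-1}, 1) / n`, which generates the coefficient lattice of
`Δ(-b_1, …, -b_{d-1}, n)`. -/
theorem IsCoeffGenerator.coeffLattice_eq_standard {d : ℕ} {ι : Type*}
    {v : Fin d ⊕ Fin d → ι → ℤ} {n : ℕ} {u : Fin d ⊕ Fin d → ℝ} {last : Fin d}
    (hlast : last.val = d - 1) (hu : IsCoeffGenerator v (Sum.inr last) n u)
    (hpair : ∀ x ∈ coeffLattice v, ∀ i, ∃ m : ℤ, x (Sum.inl i) + x (Sum.inr i) = m)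
    {b : Fin d ⊕ Fin d → ℤ} (hb : ∀ i, n * u i = b i) :
    coeffLattice v = coeffLattice (cayleyVertex 0
      (standardEndpoint (fun t => -b (Sum.inr (t.castLE (Nat.sub_le d 1)))) n)) := by
  have hn : (n : ℝ) ≠ 0 := Nat.cast_ne_zero.mpr hu.pos.ne'
  ext x
  rw [mem_coeffLattice_standard_iff _ _ hlast]
  constructor
  · intro hx
    refine ⟨hpair x hx, fun l hl => ?_, ?_⟩
    · obtain ⟨m, z, rfl⟩ := hu.exists_eq x hx
      refine ⟨z (Sum.inr l) - z (Sum.inr last) * b (Sum.inr l), ?_⟩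
      have : (⟨l, hl⟩ : Fin (d - 1)).castLE (Nat.sub_le d 1) = l := rfl
      rw [this]
      simp only [Pi.add_apply, realVec]
      rw [Pi.smul_apply, Pi.smul_apply, zsmul_eq_mul, zsmul_eq_mul, hu.apply_eq]
      push_cast
      rw [← hb (Sum.inr l)]
      field_simp
      ring
    · obtain ⟨m, z, rfl⟩ := hu.exists_eq x hx
      refine ⟨m + z (Sum.inr last) * n, ?_⟩
      rw [Pi.add_apply, Pi.smul_apply, zsmul_eq_mul, hu.apply_eq, realVec]
      push_cast
      field_simp
  · rintro ⟨h1, h2, m, hm⟩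
    push_cast at hm
    have hr : ∀ l, ∃ t : ℤ, (x - m • u) (Sum.inr l) = t := by
      intro l
      rw [Pi.sub_apply, Pi.smul_apply, zsmul_eq_mul]
      by_cases hl : l.val < d - 1
      · obtain ⟨t, ht⟩ := h2 l hl
        have : (⟨l, hl⟩ : Fin (d - 1)).castLE (Nat.sub_le d 1) = l := rfl
        rw [this] at ht
        push_cast at ht
        refine ⟨t, ?_⟩
        rw [← ht, ← hb, ← hm]
        ring
      · have : l = last := Fin.ext (by have := l.isLt; lia)
        refine ⟨0, ?_⟩
        rw [this, hu.apply_eq, ← hm]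
        field_simp
        simp
    have hall : ∀ i, ∃ t : ℤ, (x - m • u) i = t := by
      rintro (l | l)
      · obtain ⟨t, ht⟩ := hr l
        obtain ⟨s, hs⟩ := h1 l
        obtain ⟨s', hs'⟩ := hpair _ (zsmul_mem hu.mem m) l
        refine ⟨s - s' - t, ?_⟩
        push_cast
        rw [← hs, ← hs', ← ht, Pi.sub_apply, Pi.sub_apply]
        ring
      · exact hr l
    choose z hz using hall
    have : x = m • u + realVec z := by
      ext i
      rw [Pi.add_apply, realVec, ← hz, Pi.sub_apply]
      ring
    rw [this]
    exact add_mem (zsmul_mem hu.mem m) (realVec_mem_coeffLattice v z)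

/-! ### The equivalence -/

theorem mainTheorem5 (d : ℕ) (hd : 1 ≤ d)
    (v : Fin (2 * d) → Fin (2 * d - 1) → ℤ)
    (hv : IsLatticeSimplex v)
    (hfacets : ∀ j : Fin (2 * d), IsBasicLatticeSimplex (facet v j)) :
    List.TFAE [
      ∀ k : ℕ, 1 ≤ k → k < d → ∀ x : Fin (2 * d - 1) → ℤ,
        realVec x ∈ (k : ℝ) • latticeHull v →
          ∃ c : Fin (2 * d) → ℤ, ∑ i, c i = (k : ℤ) ∧ x = ∑ i, c i • v i,
      ∀ k : ℕ, 1 ≤ k → k < d →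
        interior ((k : ℝ) • latticeHull v) ∩ Set.range realVec = ∅,
      ∃ n : ℤ, 1 ≤ n ∧
        hStar (latticeHull v) = 1 + PowerSeries.C (n - 1) * PowerSeries.X ^ d,
      ∃ (a : Fin (d - 1) → ℤ) (n : ℤ), 0 < n ∧ IsCoprime (∏ i, a i) n ∧
        LatticeIsomorphic (latticeHull v) (standardCayley a n),
      ∃ p q : Fin d → Fin d → ℤ, (∀ i, p i ≠ q i) ∧
        LatticeIsomorphic (latticeHull v)
          (cayley fun i : Fin d => segment ℝ (realVec (p i)) (realVec (q i)))] := by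
  have hcard : Fintype.card (Fin (2 * d)) = 2 * d - 1 + 1 := by rw [Fintype.card_fin]; lia
  have hcard' : Fintype.card (Fin (2 * d)) = Fintype.card (Fin (2 * d - 1)) + 1 := by
    rw [hcard, Fintype.card_fin]
  have hd2 : Fintype.card (Fin (2 * d)) = 2 * d := Fintype.card_fin _
  have hF : IsFacetBasic v := fun x hx j => exists_eq_realVec_of_facet_basic (hfacets j) hx
  have hgen : ∀ j, ∃ n u, IsCoeffGenerator v j n u := fun j => by
    obtain ⟨n, hn, u, hu, huj, hall⟩ := exists_generator_coeffLattice hv hcard' (hfacets j)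
    exact ⟨n, u, hn, hu, huj, hall⟩
  let j₀ : Fin (2 * d) := ⟨0, by lia⟩
  obtain ⟨n₀, u₀, hu₀⟩ := hgen j₀
  let last : Fin d := ⟨d - 1, by lia⟩
  have hlast : last.val = d - 1 := rfl
  -- all conditions are compared with the one on the heights
  have h1 := hasConstantHeight_iff_integral_combination hv hcard' hF hd2
  have h2 := hasConstantHeight_iff_interior hv hcard' hF hd2
  have h3 := hasConstantHeight_iff_hStar hu₀ hv hcard hF hd2
  have h4 : HasConstantHeight v d →
      ∃ (a : Fin (d - 1) → ℤ) (n : ℤ), 0 < n ∧ IsCoprime (∏ i, a i) n ∧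
        LatticeIsomorphic (latticeHull v) (standardCayley a n) := by
    intro h
    obtain ⟨e, he⟩ := h.exists_pairing hu₀ hF
    -- a new generator, normalized at the vertex in the last position of the pairing
    obtain ⟨n, u, hu'⟩ := hgen (e (Sum.inr last))
    have hu := hu'.comp_equiv e
    have hFe := hF.comp_equiv e
    obtain ⟨b, hb⟩ := hu.exists_nsmul_eq hFe
    have hn : (n : ℤ) ≠ 0 := Nat.cast_ne_zero.mpr hu.pos.ne'
    refine ⟨fun t => -b (Sum.inr (t.castLE (Nat.sub_le d 1))), n, by exact_mod_cast hu.pos,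
      IsCoprime.prod_left fun t _ => (hu.isCoprime hFe hb _).neg_left, ?_⟩
    have hpair : ∀ x ∈ coeffLattice (v ∘ e), ∀ i,
        ∃ m : ℤ, x (Sum.inl i) + x (Sum.inr i) = m := fun x hx i => by
      simpa using he _ (comp_symm_mem_coeffLattice e hx) i
    rw [standardCayley_eq_latticeHull, ← latticeHull_comp_equiv e]
    exact latticeIsomorphic_of_coeffLattice_eq (hv.comp_embedding e.toEmbedding)
      (isLatticeSimplex_standard _ hn hlast) ((Fintype.card_congr e).trans hcard')
      (hu.coeffLattice_eq_standard hlast hpair hb)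
  tfae_have 1 ↔ 2 := h1.trans h2.symm
  tfae_have 2 ↔ 3 := h2.trans h3.symm
  tfae_have 2 → 4 := fun h => h4 (h2.mp h)
  tfae_have 4 → 5 := by
    rintro ⟨a, n, hn, -, hiso⟩
    refine ⟨0, standardEndpoint a n, fun i hi => ?_, ?_⟩
    · by_cases hl : i.val < d - 1
      · have := congrFun hi i
        simp [standardEndpoint, hl] at this
      · have := congrFun hi last
        simp only [standardEndpoint, if_neg hl, Pi.zero_apply, hlast, lt_irrefl,
          dif_neg not_false] at this
        exact hn.ne this
    · simpa only [standardCayley, Pi.zero_apply, realVec_zero] using hiso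
  tfae_have 5 → 2 := by
    rintro ⟨p, q, -, hiso⟩
    refine h2.mpr ?_
    have := hF.hasConstantHeight_of_latticeIsomorphic_cayley hv hcard'
      (by rw [hd2, Fintype.card_fin]) _ (fun i => ⟨_, left_mem_segment ℝ _ _⟩) hiso
    rwa [Fintype.card_fin] at this
  tfae_finish
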